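/- Let $(P^{(k)})_{k}$ be a family of column-stochastic real matrices, $P=P^{(k)}$ of size $N\times N$ with $N=N_k\ge 1$. Put $|\phi_i\rangle=\sum_{j=0}^{N-1}\sqrt{P_{j,i}}\,|j\rangle$, $|\psi_i\rangle=|i\rangle\otimes|\phi_i\rangle$, $\Pi=\sum_{i}|\psi_i\rangle\langle\psi_i|$, $\mathcal S=\sum_{i,j}|i,j\rangle\langle j,i|$, and let $U_{walk}=\mathcal S(2\Pi-I)$ be the Szegedy walk operator on $\mathbb C^N\otimes\mathbb C^N$. A family of operators $A^{(k)}$ on $\mathbb C^{N_k}\otimes\mathbb C^{N_k}$ is called *efficiently implementable* if there is a polynomial bound in $\log N_k$ and $m$ such that, for all $k$ and all $m\in\mathbb N$, some quantum circuit on two registers of $\lceil\log_2 N_k\rceil$ qubits and some ancilla qubits, with at most that many (arbitrary) one- and two-qubit gates, maps $|\psi\rangle|0\rangle$ to $(A^{(k)}|\psi\rangle)|0\rangle$ up to an error of at most $2^{-m}\|\psi\|$, for all $|\psi\rangle\in\mathbb C^{N_k}\otimes\mathbb C^{N_k}$ (basis states being encoded in binary and $|0\rangle$ being the ancilla state). For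 each $k$, fix a reference index $r$ and unitary $N\times N$ matrices $T_i$ with $T_i|\phi_i\rangle=|\phi_r\rangle$ for $0\le i<N$, and let $\mathcal T=\sum_i|i\rangle\langle i|\otimes T_i$. Suppose that 1. $\mathcal T$ and $\mathcal T^{-1}$ are efficiently implementable; 2. for each $k$ there are equally spaced points $z_j=z_0+j\,\Delta z$ ($0\le j\le N$, $\Delta z>0$) and a probability density function $p$ on $[z_0,z_N]$ with $P_{j,r}=\int_{z_j}^{z_{j+1}}p(z)\,dz$ for $0\le j<N$; 3. $p$ is classically efficiently integrable: for all $k$ and $m$ there is a Boolean circuit with a number of gates bounded by a polynomial in $\log N_k$ and $m$ (the same polynomial for all $k,m$) that computes, from the binary representations of $i\le j\le N_k$, the integral $\int_{z_i}^{z_j}p(z)\,dz$ up to an error of at most $2^{-m}$. Then $U_{walk}$ is efficiently implementable. Moreover, for every choice of computational basis states $|b\rangle$ (one for each $k$), the reference state $|\phi_r\rangle$ is efficiently preparable from $|b\rangle$: for all $k$ and $m$ there is a circuit $K_b$ on $\lceil\log_2 N_k\rceil$ qubits and some ancillas, with a number of one- and two-qubit gates polynomial in $\log N_k$ and $m$,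 such that $\|K_b|b\rangle|0\rangle-|\phi_r\rangle|0\rangle\|\le 2^{-m}$. -/

import Mathlib

open scoped Matrix

noncomputable section

namespace SzegedyWalk

/-! ### The Szegedy walk of a Markov chain -/

/-- The state `|φ_i⟩ = ∑_j √P_{j,i} |j⟩`: the square root of the `i`-th column of the
(column-stochastic) transition matrix `P`. -/
def colState {N : ℕ} (P : Matrix (Fin N) (Fin N) ℝ) (i : Fin N) : Fin N → ℂ :=
  fun j => (Real.sqrt (P j i) : ℂ)

/-- The projector state `|ψ_i⟩ = |i⟩ ⊗ |φ_i⟩` of the two-register space. -/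
def projState {N : ℕ} (P : Matrix (Fin N) (Fin N) ℝ) (i : Fin N) : Fin N × Fin N → ℂ :=
  fun x => (Pi.single i (1 : ℂ) : Fin N → ℂ) x.1 * colState P i x.2

/-- `Π = ∑_i |ψ_i⟩⟨ψ_i|`. -/
def projector {N : ℕ} (P : Matrix (Fin N) (Fin N) ℝ) :
    Matrix (Fin N × Fin N) (Fin N × Fin N) ℂ :=
  ∑ i, Matrix.vecMulVec (projState P i) (star (projState P i))

/-- The swap operator `𝒮 = ∑_{i,j} |i,j⟩⟨j,i|`. -/
def swapOp (N : ℕ) : Matrix (Fin N × Fin N) (Fin N × Fin N) ℂ :=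
  ∑ i : Fin N, ∑ j : Fin N, Matrix.single (i, j) (j, i) (1 : ℂ)

/-- The walk operator `U_walk = 𝒮 (2 Π - I)`. -/
def walkOp {N : ℕ} (P : Matrix (Fin N) (Fin N) ℝ) :
    Matrix (Fin N × Fin N) (Fin N × Fin N) ℂ :=
  swapOp N * ((2 : ℂ) • projector P - 1)

/-- The block-diagonal operator `𝒯 = ∑_i |i⟩⟨i| ⊗ T_i`. -/
def controlledOp {N : ℕ} (T : Fin N → Matrix (Fin N) (Fin N) ℂ) :
    Matrix (Fin N × Fin N) (Fin N × Fin N) ℂ :=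
  ∑ i, Matrix.kronecker (Matrix.single i i (1 : ℂ)) (T i)

/-! ### Quantum circuits of one- and two-qubit gates -/

/-- A gate on the qubits `Q`: an arbitrary unitary on one qubit, or on two distinct qubits. -/
inductive QGate (Q : Type) : Type
  | one (a : Q) (U : Matrix.unitaryGroup Bool ℂ) : QGate Q
  | two (a b : Q) (hab : a ≠ b) (U : Matrix.unitaryGroup (Bool × Bool) ℂ) : QGate Q

/-- The action of a gate on all the qubits (computational basis `Q → Bool`): the given unitary on
the qubits of the gate, the identity on all others. -/
def QGate.toMatrix {Q : Type} [Fintype Q] [DecidableEq Q] :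
    QGate Q → Matrix (Q → Bool) (Q → Bool) ℂ
  | .one a U => Matrix.of fun x y =>
      if ∀ c, c ≠ a → x c = y c then (U : Matrix Bool Bool ℂ) (x a) (y a) else 0
  | .two a b _ U => Matrix.of fun x y =>
      if ∀ c, c ≠ a → c ≠ b → x c = y c then
        (U : Matrix (Bool × Bool) (Bool × Bool) ℂ) (x a, x b) (y a, y b) else 0

/-- A quantum circuit: a list of gates, the head being applied first. Its size is its length. -/
abbrev QCircuit (Q : Type) : Type := List (QGate Q)

/-- The unitary matrix of a circuit. -/
def QCircuit.toMatrix {Q : Type} [Fintype Q] [DecidableEq Q] :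
    QCircuit Q → Matrix (Q → Bool) (Q → Bool) ℂ
  | [] => 1
  | g :: C => QCircuit.toMatrix C * g.toMatrix

/-- The state of the qubits `Q` that carries the state `ψ` on the basis states `e i`. -/
def embed {α Q : Type} [Fintype α] [Fintype Q] [DecidableEq Q] (e : α → Q → Bool)
    (ψ : EuclideanSpace ℂ α) : EuclideanSpace ℂ (Q → Bool) :=
  WithLp.toLp 2 fun x => ∑ i, if e i = x then ψ i else 0

/-- The number `⌈log₂ N⌉` of qubits of a register with `N` basis states. -/
abbrev regSize (N : ℕ) : ℕ := Nat.clog 2 N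

/-- One register in the basis state `|i⟩` (in binary) and `a` ancilla qubits in state `|0⟩`. -/
def enc₁ (N a : ℕ) (i : Fin N) : Fin (regSize N) ⊕ Fin a → Bool :=
  Sum.elim (fun t => Nat.testBit i t) fun _ => false

/-- Two registers in the basis state `|i, j⟩` (in binary) and `a` ancilla qubits in state `|0⟩`. -/
def enc₂ (N a : ℕ) (x : Fin N × Fin N) :
    (Fin (regSize N) ⊕ Fin (regSize N)) ⊕ Fin a → Bool :=
  Sum.elim (Sum.elim (fun t => Nat.testBit x.1 t) fun t => Nat.testBit x.2 t) fun _ => false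

/-- The circuit `C` implements the operator `A` on the states encoded by `e` up to an error `ε` in
operator norm. The ancillas that `e` sets to `|0⟩` are returned to `|0⟩` within this error. -/
def Implements {α Q : Type} [Fintype α] [DecidableEq α] [Fintype Q] [DecidableEq Q]
    (e : α → Q → Bool) (C : QCircuit Q) (A : Matrix α α ℂ) (ε : ℝ) : Prop :=
  ∀ ψ : EuclideanSpace ℂ α,
    ‖Matrix.toEuclideanLin (QCircuit.toMatrix C) (embed e ψ)
      - embed e (Matrix.toEuclideanLin A ψ)‖ ≤ ε * ‖ψ‖

/-- A family of operators on two registers of dimension `N k` each is efficiently implementable: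
every accuracy `2⁻ᵐ` is reached with a number of one- and two-qubit gates that is polynomial in
`log (N k)` and `m`. -/
def EfficientlyImplementable {ι : Type*} (N : ι → ℕ)
    (A : ∀ k, Matrix (Fin (N k) × Fin (N k)) (Fin (N k) × Fin (N k)) ℂ) : Prop :=
  ∃ c d : ℕ, ∀ (k : ι) (m : ℕ),
    ∃ (a : ℕ) (C : QCircuit ((Fin (regSize (N k)) ⊕ Fin (regSize (N k))) ⊕ Fin a)),
      C.length ≤ c * (regSize (N k) + m + 1) ^ d ∧
      Implements (enc₂ (N k) a) C (A k) ((1 / 2 : ℝ) ^ m)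

/-- A family of states `φ k` of one register is efficiently preparable from the computational basis
states `b k`: for every accuracy `2⁻ᵐ` there is a circuit `K` with a number of gates polynomial in
`log (N k)` and `m` and with `‖K |b⟩|0⟩ - |φ⟩|0⟩‖ ≤ 2⁻ᵐ`. (Then the reversed circuit, which is
`K†`, takes `|φ⟩|0⟩` to `|b⟩|0⟩` within the same error.) -/
def EfficientlyPreparable {ι : Type*} (N : ι → ℕ) (b : ∀ k, Fin (N k))
    (φ : ∀ k, Fin (N k) → ℂ) : Prop :=
  ∃ c d : ℕ, ∀ (k : ι) (m : ℕ),
    ∃ (a : ℕ) (K : QCircuit (Fin (regSize (N k)) ⊕ Fin a)),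
      K.length ≤ c * (regSize (N k) + m + 1) ^ d ∧
      ‖Matrix.toEuclideanLin (QCircuit.toMatrix K)
          (embed (enc₁ (N k) a) (EuclideanSpace.single (b k) 1))
        - embed (enc₁ (N k) a) (WithLp.toLp 2 (φ k))‖ ≤ (1 / 2 : ℝ) ^ m

/-! ### Classical circuits and efficient integration -/

/-- A Boolean circuit as a straight-line program over NAND gates: each gate `(s, t)` appends the
NAND of the wires `s` and `t` to the list of wires, which starts with the input bits; the outputs
are `o` chosen wires. -/
structure BoolCircuit (o : ℕ) : Type where
  gates : List (ℕ × ℕ)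
  out : Fin o → ℕ

/-- All wires of a straight-line program over NAND gates on the input `x`. Wires that do not exist
read as `false`. -/
def runNand : List (ℕ × ℕ) → List Bool → List Bool
  | [], x => x
  | g :: gs, x => runNand gs (x ++ [!(x.getD g.1 false && x.getD g.2 false)])

/-- The natural number that a Boolean circuit outputs in binary (least significant bit first). -/
def BoolCircuit.eval {o : ℕ} (C : BoolCircuit o) (x : List Bool) : ℕ :=
  ∑ t : Fin o, ((runNand C.gates x).getD (C.out t) false).toNat * 2 ^ (t : ℕ)

/-- The `w` lowest binary digits of `n`, least significant first. -/
def bits (w n : ℕ) : List Bool := (List.range w).map fun t => n.testBit t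

/-- `p` is a probability density function on `[a, b]`. -/
def IsDensityOn (p : ℝ → ℝ) (a b : ℝ) : Prop :=
  (∀ z ∈ Set.Icc a b, 0 ≤ p z) ∧ IntervalIntegrable p MeasureTheory.volume a b ∧
    ∫ z in a..b, p z = 1

/-- The densities `p k` are (classically) efficiently integrable on the grids
`z_i = z₀ k + i * Δz k`, `0 ≤ i ≤ N k`: there are Boolean circuits that compute, from `i ≤ j` in
binary, the integral of `p k` from `z_i` to `z_j` with accuracy `2⁻ᵐ`, as a binary number with `m`
fractional bits, using a number of gates polynomial in `log (N k)` and `m`. -/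
def EfficientlyIntegrable {ι : Type*} (N : ι → ℕ) (p : ι → ℝ → ℝ) (z₀ Δz : ι → ℝ) : Prop :=
  ∃ c d : ℕ, ∀ (k : ι) (m : ℕ), ∃ C : BoolCircuit (m + 1),
    C.gates.length ≤ c * (regSize (N k) + m + 1) ^ d ∧
    ∀ i j : ℕ, i ≤ j → j ≤ N k →
      |(C.eval (bits (Nat.size (N k)) i ++ bits (Nat.size (N k)) j) : ℝ) / 2 ^ m
        - ∫ z in (z₀ k + i * Δz k)..(z₀ k + j * Δz k), p k z| ≤ (1 / 2 : ℝ) ^ m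

end SzegedyWalk

end

/-! The walk operator factors through the reference state. Since T_i carries φ_i to φ_r, conjugating
the reflection 2|φ_r⟩⟨φ_r| - I by T_i gives the reflection about φ_i; block by block, 2Π - I = 𝒯⁻¹
(I ⊗ (2|φ_r⟩⟨φ_r| - I)) 𝒯 (`walkOp_eq`). The factors 𝒯 and 𝒯⁻¹ are cheap by hypothesis, and the swap
takes three CNOTs per pair of qubits. If K approximately prepares φ_r from |0⟩, then K (2|0⟩⟨0| - I)
K† approximates the middle factor (`impl_reflection`). Both claims thus reduce to preparing φ_r.

The preparation refines the state from the leading qubit downwards (the Grover-Rudolph method). A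
block of 2^(t+1) consecutive basis states carries the square root of its mass as amplitude on its
lowest state; a rotation of qubit t by θ, with cos² θ the share of the lower half, splits it into
two blocks (`transforms_level`). Masses of blocks are integrals of p between grid points, which the
given Boolean circuits approximate.

The angle needs neither a square root nor an arccosine. It is expanded greedily in the angles arctan
2⁻ˢ, each digit being decided by comparing integers, as in the CORDIC algorithm (`cordic_spec`), and
each digit controls one exact rotation by arctan 2⁻ˢ. The integer arithmetic is a NAND program that
runs reversibly on fresh ancillas and is undone after the rotations (`Reach.exists_rotation`).

Errors are added up over basis states by the triangle inequality, which loses factors of order 2^n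
with n the register size. Precision is cheap enough to absorb this: O(n) further bits keep the gate
count polynomial. -/

set_option linter.unusedSectionVars false

noncomputable section

namespace SzegedyWalk

/-! ### Circuits acting on states -/

section Action

variable {Q : Type} [Fintype Q] [DecidableEq Q]

/-- A computational basis state. -/
abbrev ket (y : Q → Bool) : EuclideanSpace ℂ (Q → Bool) := EuclideanSpace.single y 1

/-- The action of a gate on states. -/
def gateAct (g : QGate Q) : EuclideanSpace ℂ (Q → Bool) →ₗ[ℂ] EuclideanSpace ℂ (Q → Bool) :=
  Matrix.toEuclideanLin g.toMatrix

/-- The action of a circuit on states. -/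
def act (C : QCircuit Q) : EuclideanSpace ℂ (Q → Bool) →ₗ[ℂ] EuclideanSpace ℂ (Q → Bool) :=
  Matrix.toEuclideanLin (QCircuit.toMatrix C)

@[simp] lemma act_nil (ψ : EuclideanSpace ℂ (Q → Bool)) : act ([] : QCircuit Q) ψ = ψ := by
  simp [act, QCircuit.toMatrix]

lemma toEuclideanLin_mul {α : Type*} [Fintype α] [DecidableEq α] (A B : Matrix α α ℂ)
    (ψ : EuclideanSpace ℂ α) :
    Matrix.toEuclideanLin (A * B) ψ = Matrix.toEuclideanLin A (Matrix.toEuclideanLin B ψ) := by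
  simp [Matrix.toLpLin_apply]

@[simp] lemma act_cons (g : QGate Q) (C : QCircuit Q) (ψ : EuclideanSpace ℂ (Q → Bool)) :
    act (g :: C) ψ = act C (gateAct g ψ) := by
  simp only [act, QCircuit.toMatrix, gateAct, toEuclideanLin_mul]

lemma act_append (C D : QCircuit Q) (ψ : EuclideanSpace ℂ (Q → Bool)) :
    act (C ++ D) ψ = act D (act C ψ) := by
  induction C generalizing ψ with
  | nil => simp
  | cons g C ih => rw [List.cons_append, act_cons, act_cons, ih]

/-- Every identity between circuit actions below is reduced by this to computational basis states.
-/
lemma lin_ext {α : Type*} [Fintype α] [DecidableEq α] {V : Type*} [AddCommGroup V] [Module ℂ V]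
    {f g : EuclideanSpace ℂ α →ₗ[ℂ] V}
    (h : ∀ i, f (EuclideanSpace.single i 1) = g (EuclideanSpace.single i 1)) : f = g := by
  apply (EuclideanSpace.basisFun α ℂ).toBasis.ext
  simpa using h

lemma toEuclideanLin_single {α : Type*} [Fintype α] [DecidableEq α] (A : Matrix α α ℂ) (y x : α) :
    Matrix.toEuclideanLin A (EuclideanSpace.single y 1) x = A x y := by
  simp [Matrix.toLpLin_apply, Matrix.mulVec_single]

lemma gateAct_one_ket (a : Q) (U : Matrix.unitaryGroup Bool ℂ) (y : Q → Bool) :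
    gateAct (.one a U) (ket y) =
      ∑ b, (U : Matrix Bool Bool ℂ) b (y a) • ket (Function.update y a b) := by
  ext x
  rw [gateAct, toEuclideanLin_single]
  simp only [QGate.toMatrix, Matrix.of_apply, WithLp.ofLp_sum, WithLp.ofLp_smul, Finset.sum_apply,
    Pi.smul_apply, smul_eq_mul, PiLp.single_apply, mul_ite, mul_one, mul_zero]
  by_cases h : ∀ c, c ≠ a → x c = y c
  · rw [if_pos h, Finset.sum_eq_single (x a)]
    · rw [if_pos]
      ext c
      by_cases hc : c = a
      · subst hc; simp
      · simp [hc, h c hc]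
    · intro b _ hb
      rw [if_neg]
      rintro rfl
      simp at hb
    · simp
  · rw [if_neg h, Finset.sum_eq_zero]
    intro b _
    rw [if_neg]
    rintro rfl
    exact h fun c hc => by simp [hc]

lemma gateAct_two_ket (a b : Q) (hab : a ≠ b) (U : Matrix.unitaryGroup (Bool × Bool) ℂ)
    (y : Q → Bool) :
    gateAct (.two a b hab U) (ket y) =
      ∑ p, (U : Matrix (Bool × Bool) (Bool × Bool) ℂ) p (y a, y b) •
        ket (Function.update (Function.update y a p.1) b p.2) := by
  ext x
  rw [gateAct, toEuclideanLin_single]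
  simp only [QGate.toMatrix, Matrix.of_apply, WithLp.ofLp_sum, WithLp.ofLp_smul, Finset.sum_apply,
    Pi.smul_apply, smul_eq_mul, PiLp.single_apply, mul_ite, mul_one, mul_zero]
  by_cases h : ∀ c, c ≠ a → c ≠ b → x c = y c
  · rw [if_pos h, Finset.sum_eq_single (x a, x b)]
    · rw [if_pos]
      ext c
      by_cases hc : c = b
      · subst hc; simp
      · by_cases hc' : c = a
        · subst hc'; simp [hc]
        · simp [hc, hc', h c hc' hc]
    · rintro ⟨p, q⟩ _ hb
      rw [if_neg]
      rintro rfl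
      simp [hab] at hb
    · simp
  · rw [if_neg h, Finset.sum_eq_zero]
    intro b _
    rw [if_neg]
    rintro rfl
    exact h fun c hc hc' => by simp [hc, hc']

/-! ### Inverse circuits and unitarity -/

/-- The inverse gate. -/
def gateInv : QGate Q → QGate Q
  | .one a U => .one a U⁻¹
  | .two a b h U => .two a b h U⁻¹

/-- The inverse circuit. -/
def circInv (C : QCircuit Q) : QCircuit Q := (C.map gateInv).reverse

@[simp] lemma length_circInv (C : QCircuit Q) : (circInv C).length = C.length := by
  simp [circInv]

lemma gateAct_one_mul (a : Q) (U V : Matrix.unitaryGroup Bool ℂ)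
    (ψ : EuclideanSpace ℂ (Q → Bool)) :
    gateAct (.one a U) (gateAct (.one a V) ψ) = gateAct (.one a (U * V)) ψ := by
  suffices h : gateAct (.one a U) ∘ₗ gateAct (.one a V) = gateAct (.one a (U * V)) from
    LinearMap.congr_fun h ψ
  apply lin_ext
  intro y
  rw [LinearMap.comp_apply]
  simp only [gateAct_one_ket, map_sum, map_smul, Finset.smul_sum, smul_smul,
    Function.update_self, Function.update_idem]
  rw [Finset.sum_comm]
  refine Finset.sum_congr rfl fun b _ => ?_
  rw [← Finset.sum_smul]
  congr 1
  simp [Matrix.mul_apply, mul_comm]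

@[simp] lemma gateAct_one_one (a : Q) (ψ : EuclideanSpace ℂ (Q → Bool)) :
    gateAct (.one a 1) ψ = ψ := by
  suffices h : gateAct (.one a 1) = LinearMap.id from LinearMap.congr_fun h ψ
  apply lin_ext
  intro y
  rw [gateAct_one_ket, Finset.sum_eq_single (y a)]
  · simp
  · intro b _ hb
    simp [hb]
  · simp

lemma gateAct_gateInv (g : QGate Q) (ψ : EuclideanSpace ℂ (Q → Bool)) :
    gateAct (gateInv g) (gateAct g ψ) = ψ := by
  cases g with
  | one a U => simp [gateInv, gateAct_one_mul]
  | two a b hab U =>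
    suffices h : gateAct (.two a b hab U⁻¹) ∘ₗ gateAct (.two a b hab U) = LinearMap.id from
      LinearMap.congr_fun h ψ
    apply lin_ext
    intro y
    rw [LinearMap.comp_apply]
    have hu : ∀ (p q : Bool × Bool), Function.update (Function.update (Function.update
        (Function.update y a p.1) b p.2) a q.1) b q.2 =
        Function.update (Function.update y a q.1) b q.2 := by
      intro p q
      rw [Function.update_comm hab.symm, Function.update_idem, Function.update_idem]
    simp only [gateAct_two_ket, map_sum, map_smul, Finset.smul_sum, smul_smul,
      Function.update_self, hu, Function.update_of_ne hab]
    rw [Finset.sum_comm]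
    have hm : (U⁻¹ : Matrix.unitaryGroup (Bool × Bool) ℂ).1 * U.1 = 1 := by
      rw [← Submonoid.coe_mul, inv_mul_cancel, Submonoid.coe_one]
    have : ∀ q : Bool × Bool, ∑ p : Bool × Bool, (U.1 p (y a, y b) *
        (U⁻¹ : Matrix.unitaryGroup (Bool × Bool) ℂ).1 q p) • ket
          (Function.update (Function.update y a q.1) b q.2) =
        (1 : Matrix (Bool × Bool) (Bool × Bool) ℂ) q (y a, y b) • ket
          (Function.update (Function.update y a q.1) b q.2) := by
      intro q
      rw [← Finset.sum_smul]
      congr 1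
      rw [← hm]
      simp [Matrix.mul_apply, mul_comm]
    rw [Finset.sum_congr rfl fun q _ => this q, Finset.sum_eq_single (y a, y b)]
    · simp
    · intro q _ hq
      simp [hq]
    · simp

@[simp] lemma act_circInv_act (C : QCircuit Q) (ψ : EuclideanSpace ℂ (Q → Bool)) :
    act (circInv C) (act C ψ) = ψ := by
  induction C generalizing ψ with
  | nil => simp [circInv]
  | cons g C ih =>
    have : circInv (g :: C) = circInv C ++ [gateInv g] := by simp [circInv]
    simp [this, act_append, ih, gateAct_gateInv]

lemma gateInv_gateInv (g : QGate Q) : gateInv (gateInv g) = g := by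
  cases g <;> simp [gateInv]

lemma circInv_circInv (C : QCircuit Q) : circInv (circInv C) = C := by
  simp only [circInv, List.map_reverse, List.reverse_reverse, List.map_map]
  conv_rhs => rw [← List.map_id C]
  exact List.map_congr_left fun g _ => gateInv_gateInv g

lemma act_act_circInv (C : QCircuit Q) (ψ : EuclideanSpace ℂ (Q → Bool)) :
    act C (act (circInv C) ψ) = ψ := by
  simpa [circInv_circInv] using act_circInv_act (circInv C) ψ

lemma toMatrix_gateInv (g : QGate Q) : (gateInv g).toMatrix = (g.toMatrix)ᴴ := by
  cases g with
  | one a U =>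
    ext x y
    simp only [gateInv, QGate.toMatrix, Matrix.of_apply, Matrix.conjTranspose_apply, apply_ite star,
      star_zero]
    simp only [eq_comm (a := x _)]
    rfl
  | two a b h U =>
    ext x y
    simp only [gateInv, QGate.toMatrix, Matrix.of_apply, Matrix.conjTranspose_apply, apply_ite star,
      star_zero]
    simp only [eq_comm (a := x _)]
    rfl

lemma inner_act_left (C : QCircuit Q) (ψ χ : EuclideanSpace ℂ (Q → Bool)) :
    inner ℂ (act C ψ) χ = inner ℂ ψ (act (circInv C) χ) := by
  induction C generalizing ψ χ with
  | nil => simp [circInv]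
  | cons g C ih =>
    have : circInv (g :: C) = circInv C ++ [gateInv g] := by simp [circInv]
    rw [this, act_append, act_cons, ih, act_cons, act_nil, gateAct, gateAct, toMatrix_gateInv,
      Matrix.toEuclideanLin_conjTranspose_eq_adjoint, LinearMap.adjoint_inner_right]

-- The inverse circuit is at once the adjoint and a left inverse.
@[simp] lemma norm_act (C : QCircuit Q) (ψ : EuclideanSpace ℂ (Q → Bool)) : ‖act C ψ‖ = ‖ψ‖ := by
  rw [@norm_eq_sqrt_re_inner ℂ, @norm_eq_sqrt_re_inner ℂ, inner_act_left, act_circInv_act]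

end Action

/-! ### Embedding states -/

section Embed

variable {α Q Q' : Type} [Fintype α] [Fintype Q] [DecidableEq Q] [Fintype Q'] [DecidableEq Q']

/-- `embed e` as a linear map. -/
def embedLin (e : α → Q → Bool) :
    EuclideanSpace ℂ α →ₗ[ℂ] EuclideanSpace ℂ (Q → Bool) where
  toFun := embed e
  map_add' ψ χ := by
    ext x
    simp only [embed, WithLp.ofLp_add, Pi.add_apply, ← Finset.sum_add_distrib]
    exact Finset.sum_congr rfl fun i _ => by split_ifs <;> simp
  map_smul' c ψ := by
    ext x
    simp only [embed, WithLp.ofLp_smul, Pi.smul_apply, RingHom.id_apply, smul_eq_mul,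
      Finset.mul_sum]
    exact Finset.sum_congr rfl fun i _ => by split_ifs <;> simp

lemma embedLin_apply (e : α → Q → Bool) (ψ : EuclideanSpace ℂ α) : embedLin e ψ = embed e ψ := rfl

lemma embed_single [DecidableEq α] (e : α → Q → Bool) (i : α) :
    embed e (EuclideanSpace.single i 1) = ket (e i) := by
  ext x
  simp only [embed, PiLp.single_apply]
  rw [Finset.sum_eq_single i]
  · simp [eq_comm]
  · intro j _ hj
    simp [hj]
  · simp

lemma embed_embed (e : α → Q → Bool) (e' : (Q → Bool) → Q' → Bool) (ψ : EuclideanSpace ℂ α) :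
    embed e' (embed e ψ) = embed (fun i => e' (e i)) ψ := by
  classical
  suffices h : embedLin e' ∘ₗ embedLin e = embedLin (fun i => e' (e i)) from
    LinearMap.congr_fun h ψ
  apply lin_ext
  intro i
  simp [embedLin_apply, embed_single]

lemma inner_embed {e : α → Q → Bool} (he : Function.Injective e) (ψ χ : EuclideanSpace ℂ α) :
    inner ℂ (embed e ψ) (embed e χ) = inner ℂ ψ χ := by
  classical
  have h : ∀ (ω : EuclideanSpace ℂ α) i, (embed e ω) (e i) = ω i := by
    intro ω i
    simp only [embed]
    rw [Finset.sum_eq_single i]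
    · simp
    · intro j _ hj
      rw [if_neg (he.ne hj)]
    · simp
  have h0 : ∀ (ω : EuclideanSpace ℂ α) x, x ∉ Finset.univ.image e → (embed e ω) x = 0 := by
    intro ω x hx
    simp only [embed]
    refine Finset.sum_eq_zero fun i _ => if_neg ?_
    rintro rfl
    simp at hx
  simp only [PiLp.inner_apply]
  rw [← Finset.sum_subset (Finset.subset_univ (Finset.univ.image e)),
    Finset.sum_image fun i _ j _ hij => he hij]
  · simp [h]
  · intro x _ hx
    simp [h0 _ x hx]

lemma norm_embed {e : α → Q → Bool} (he : Function.Injective e) (ψ : EuclideanSpace ℂ α) :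
    ‖embed e ψ‖ = ‖ψ‖ := by
  rw [@norm_eq_sqrt_re_inner ℂ, @norm_eq_sqrt_re_inner ℂ, inner_embed he]

/-! ### Circuits on more qubits -/

/-- A gate on renamed qubits. -/
def gateMap (f : Q ↪ Q') : QGate Q → QGate Q'
  | .one a U => .one (f a) U
  | .two a b h U => .two (f a) (f b) (f.injective.ne h) U

/-- A circuit on renamed qubits. -/
def circMap (f : Q ↪ Q') (C : QCircuit Q) : QCircuit Q' := C.map (gateMap f)

@[simp] lemma length_circMap (f : Q ↪ Q') (C : QCircuit Q) :
    (circMap f C).length = C.length := by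
  simp [circMap]

lemma extend_update (f : Q ↪ Q') (v : Q' → Bool) (x : Q → Bool) (a : Q) (b : Bool) :
    Function.extend f (Function.update x a b) v = Function.update (Function.extend f x v) (f a) b := by
  ext c
  by_cases hc : ∃ d, f d = c
  · obtain ⟨d, rfl⟩ := hc
    by_cases hd : d = a
    · subst hd
      simp [f.injective.extend_apply]
    · rw [f.injective.extend_apply, Function.update_of_ne hd,
        Function.update_of_ne (f.injective.ne hd), f.injective.extend_apply]
  · have : c ≠ f a := fun h => hc ⟨a, h.symm⟩
    rw [Function.extend_apply' _ _ _ hc, Function.update_of_ne this,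
      Function.extend_apply' _ _ _ hc]

lemma gateAct_gateMap (f : Q ↪ Q') (v : Q' → Bool) (g : QGate Q)
    (ψ : EuclideanSpace ℂ (Q → Bool)) :
    gateAct (gateMap f g) (embed (fun x => Function.extend f x v) ψ) =
      embed (fun x => Function.extend f x v) (gateAct g ψ) := by
  suffices h : gateAct (gateMap f g) ∘ₗ embedLin (fun x => Function.extend f x v) =
      embedLin (fun x => Function.extend f x v) ∘ₗ gateAct g from LinearMap.congr_fun h ψ
  apply lin_ext
  intro y
  rw [LinearMap.comp_apply, LinearMap.comp_apply, embedLin_apply, embed_single]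
  cases g with
  | one a U =>
    simp only [gateMap, gateAct_one_ket, map_sum, map_smul, embedLin_apply, embed_single,
      extend_update, f.injective.extend_apply]
  | two a b h U =>
    simp only [gateMap, gateAct_two_ket, map_sum, map_smul, embedLin_apply, embed_single,
      extend_update, f.injective.extend_apply]

/-- The qubits outside the range of `f` hold the fixed basis values `v` and are never touched. This
one form covers adding ancillas, widening the ancilla space and acting on the second register only.
-/
lemma act_circMap (f : Q ↪ Q') (v : Q' → Bool) (C : QCircuit Q)
    (ψ : EuclideanSpace ℂ (Q → Bool)) :
    act (circMap f C) (embed (fun x => Function.extend f x v) ψ) =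
      embed (fun x => Function.extend f x v) (act C ψ) := by
  induction C generalizing ψ with
  | nil => simp [circMap]
  | cons g C ih =>
    rw [act_cons, ← ih, ← gateAct_gateMap]
    simp [circMap]

lemma extend_injective (f : Q ↪ Q') (v : Q' → Bool) :
    Function.Injective fun x : Q → Bool => Function.extend f x v := by
  intro x y h
  ext a
  have := congrFun h (f a)
  simpa [f.injective.extend_apply] using this

end Embed

/-! ### Elementary gates -/

section Gates

variable {Q : Type} [Fintype Q] [DecidableEq Q]

/-- The bit flip. -/
def gateX : Matrix.unitaryGroup Bool ℂ :=
  ⟨Matrix.of fun a b => if a = b then 0 else 1, by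
    rw [Matrix.mem_unitaryGroup_iff]
    ext a b
    cases a <;> cases b <;> simp [Matrix.mul_apply, Matrix.star_apply]⟩

/-- A square root of the bit flip. -/
def gateV : Matrix.unitaryGroup Bool ℂ :=
  ⟨Matrix.of fun a b => if a = b then (1 + Complex.I) / 2 else (1 - Complex.I) / 2, by
    rw [Matrix.mem_unitaryGroup_iff]
    ext a b
    cases a <;> cases b <;> simp [Matrix.mul_apply, Matrix.star_apply, map_ofNat] <;> ring_nf <;>
      simp <;> norm_num⟩

/-- The rotation by the angle `θ`. -/
def gateR (θ : ℝ) : Matrix.unitaryGroup Bool ℂ :=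
  ⟨Matrix.of fun a b => if a = b then (Real.cos θ : ℂ) else
      if a then (Real.sin θ : ℂ) else -(Real.sin θ : ℂ), by
    have h : (Real.cos θ : ℂ) * Real.cos θ + Real.sin θ * Real.sin θ = 1 := by
      have := Real.cos_sq_add_sin_sq θ
      rw [← sq, ← sq]
      exact_mod_cast this
    rw [Matrix.mem_unitaryGroup_iff]
    ext a b
    cases a <;> cases b <;>
      simp only [Matrix.mul_apply, Matrix.star_apply, Matrix.of_apply, Fintype.sum_bool,
        RCLike.star_def, Complex.conj_ofReal, map_neg, if_true, Bool.false_eq_true, if_false,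
        Matrix.one_apply, reduceCtorEq] <;> first | linear_combination h | ring⟩

lemma gateV_mul_gateV : gateV * gateV = gateX := by
  ext a b
  cases a <;> cases b <;> simp [gateV, gateX, Matrix.mul_apply] <;> ring_nf <;> simp <;> norm_num

lemma gateR_mul (θ η : ℝ) : gateR θ * gateR η = gateR (θ + η) := by
  ext a b
  cases a <;> cases b <;>
    simp only [gateR, Submonoid.coe_mul, Matrix.mul_apply, Matrix.of_apply, Fintype.sum_bool,
      if_true, Bool.false_eq_true, if_false, Real.cos_add, Real.sin_add, reduceCtorEq] <;>
    push_cast <;> ring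

lemma gateR_zero : gateR 0 = 1 := by
  ext a b
  cases a <;> cases b <;> simp [gateR]

/-- The gate `U` on `t`, controlled by `c`. -/
def ctrl (c t : Q) (h : t ≠ c) (U : Matrix.unitaryGroup Bool ℂ) : QGate Q :=
  .two t c h ⟨Matrix.blockDiagonal fun b => if b then (U : Matrix Bool Bool ℂ) else 1, by
    rw [Matrix.mem_unitaryGroup_iff, Matrix.star_eq_conjTranspose,
      Matrix.blockDiagonal_conjTranspose, ← Matrix.blockDiagonal_mul,
      ← Matrix.blockDiagonal_one]
    congr 1
    ext1 b
    cases b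
    · simp
    · have := Matrix.mem_unitaryGroup_iff.1 U.2
      rwa [Matrix.star_eq_conjTranspose] at this⟩

lemma gateAct_ctrl_ket (c t : Q) (h : t ≠ c) (U : Matrix.unitaryGroup Bool ℂ) (y : Q → Bool) :
    gateAct (ctrl c t h U) (ket y) = if y c then gateAct (.one t U) (ket y) else ket y := by
  have hy : ∀ b, Function.update (Function.update y t b) c (y c) = Function.update y t b :=
    fun b => by rw [← Function.update_of_ne h.symm b y, Function.update_eq_self]
  rw [ctrl, gateAct_two_ket, Fintype.sum_prod_type]
  rw [Finset.sum_congr rfl fun b _ => Finset.sum_eq_single (y c) (by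
    intro d _ hd
    simp [Matrix.blockDiagonal_apply, hd]) (by simp)]
  simp only [Matrix.blockDiagonal_apply, if_true, hy]
  cases y c
  · rw [Finset.sum_eq_single (y t)]
    · simp
    · intro b _ hb
      simp [hb]
    · simp
  · simp [gateAct_one_ket]

/-- The control is still a basis bit when only `t` has been rotated, so successive controlled gates
on `t` accumulate into a single one-qubit gate and no superposition has to be expanded. -/
lemma gateAct_ctrl_one (c t : Q) (h : t ≠ c) (U W : Matrix.unitaryGroup Bool ℂ) (y : Q → Bool) :
    gateAct (ctrl c t h U) (gateAct (.one t W) (ket y)) =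
      gateAct (.one t (if y c then U * W else W)) (ket y) := by
  have : gateAct (.one t (if y c then U * W else W)) (ket y) =
      if y c then gateAct (.one t U) (gateAct (.one t W) (ket y)) else
        gateAct (.one t W) (ket y) := by
    cases y c <;> simp [gateAct_one_mul]
  rw [this]
  simp only [gateAct_one_ket t W, map_sum, map_smul, gateAct_ctrl_ket,
    Function.update_of_ne h.symm]
  cases y c <;> simp

lemma gateAct_X_ket (a : Q) (y : Q → Bool) :
    gateAct (.one a gateX) (ket y) = ket (Function.update y a (!y a)) := by
  rw [gateAct_one_ket, Finset.sum_eq_single (!y a)]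
  · cases y a <;> simp [gateX]
  · intro b _ hb
    have : b = y a := by cases b <;> cases h : y a <;> simp_all
    simp [gateX, this]
  · simp

/-- The controlled bit flip. -/
def cnot (c t : Q) (h : t ≠ c) : QGate Q := ctrl c t h gateX

lemma gateAct_cnot_ket (c t : Q) (h : t ≠ c) (y : Q → Bool) :
    gateAct (cnot c t h) (ket y) = ket (Function.update y t (y t ^^ y c)) := by
  rw [cnot, gateAct_ctrl_ket, gateAct_X_ket]
  cases y c <;> simp

lemma gateAct_cnot_one (c d t : Q) (h : d ≠ c) (hc : c ≠ t) (hd : d ≠ t)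
    (W : Matrix.unitaryGroup Bool ℂ) (y : Q → Bool) :
    gateAct (cnot c d h) (gateAct (.one t W) (ket y)) =
      gateAct (.one t W) (ket (Function.update y d (y d ^^ y c))) := by
  simp only [gateAct_one_ket, map_sum, map_smul, gateAct_cnot_ket, Function.update_of_ne hc,
    Function.update_of_ne hd, Function.update_of_ne hd.symm, Function.update_comm hd]

/-- The circuit that adds the conjunction of `p` and `q` to `t`. -/
def toffoli (p q t : Q) (hpq : q ≠ p) (hp : t ≠ p) (hq : t ≠ q) : QCircuit Q :=
  [ctrl q t hq gateV, cnot p q hpq, ctrl q t hq gateV⁻¹, cnot p q hpq, ctrl p t hp gateV]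

/-- With V² = X, the target receives V to the power q - (p xor q) + p = 2pq. -/
lemma act_toffoli (p q t : Q) (hpq : q ≠ p) (hp : t ≠ p) (hq : t ≠ q) (y : Q → Bool) :
    act (toffoli p q t hpq hp hq) (ket y) = ket (Function.update y t (y t ^^ (y p && y q))) := by
  have h1 : ket y = gateAct (.one t 1) (ket y) := by simp
  conv_lhs => rw [h1]
  simp only [toffoli, act_cons, act_nil, gateAct_ctrl_one, gateAct_cnot_one p q t hpq hp.symm
    hq.symm, Function.update_self, Function.update_of_ne hpq.symm, Function.update_idem]
  have h2 : Function.update y q ((y q ^^ y p) ^^ y p) = y := by simp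
  rw [h2]
  have hX := gateAct_X_ket t y
  cases y p <;> cases y q <;> simp [gateV_mul_gateV, hX]

/-- The circuit that writes the NAND of `p` and `q` to the qubit `t`, which is in state `|0⟩`. -/
def nandCirc (p q t : Q) (hp : t ≠ p) (hq : t ≠ q) : QCircuit Q :=
  .one t gateX :: if h : q = p then [cnot p t hp] else toffoli p q t h hp hq

lemma length_nandCirc (p q t : Q) (hp : t ≠ p) (hq : t ≠ q) :
    (nandCirc p q t hp hq).length ≤ 6 := by
  unfold nandCirc
  split_ifs <;> simp [toffoli]

/-- The flip of `t` supplies the negation. A NAND of a wire with itself is treated apart because the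
Toffoli circuit needs distinct controls. -/
lemma act_nandCirc (p q t : Q) (hp : t ≠ p) (hq : t ≠ q) (y : Q → Bool) (hy : y t = false) :
    act (nandCirc p q t hp hq) (ket y) = ket (Function.update y t (!(y p && y q))) := by
  unfold nandCirc
  rw [act_cons, gateAct_X_ket]
  split_ifs with h
  · subst h
    simp [gateAct_cnot_ket, hy, Function.update_of_ne hp.symm]
  · simp [act_toffoli, hy, Function.update_of_ne hp.symm, Function.update_of_ne hq.symm]

end Gates

/-! ### Straight-line programs and their reversible implementation -/

/-- `Reach S n S'`: with `n` NAND gates the Boolean functions of `S` give those of `S'`. -/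
inductive Reach {X : Type*} (S : Set (X → Bool)) : ℕ → Set (X → Bool) → Prop
  | refl : Reach S 0 S
  | step {n : ℕ} {S' : Set (X → Bool)} {f g : X → Bool} (h : Reach S n S') (hf : f ∈ S')
      (hg : g ∈ S') : Reach S (n + 1) (insert (fun x => !(f x && g x)) S')
  | weaken {n m : ℕ} {S' : Set (X → Bool)} (h : Reach S n S') (hnm : n ≤ m) : Reach S m S'

lemma extend_snoc {R : Type} {a : ℕ} (β : R → Bool) (g : Fin a → Bool) :
    Function.extend ((Function.Embedding.refl R).sumMap Fin.castSuccEmb)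
      (Sum.elim β g) (fun _ => false) =
      Sum.elim β (Fin.snoc (α := fun _ => Bool) g false) := by
  set f := (Function.Embedding.refl R).sumMap (Fin.castSuccEmb (n := a))
  have h1 : ∀ r, f (Sum.inl r) = Sum.inl r := fun _ => rfl
  have h2 : ∀ i, f (Sum.inr i) = Sum.inr i.castSucc := fun _ => rfl
  ext x
  rcases x with r | i
  · rw [← h1, f.injective.extend_apply, h1]
    rfl
  · refine Fin.lastCases ?_ (fun i => ?_) i
    · rw [Function.extend_apply']
      · simp
      · rintro ⟨y | y, hy⟩
        · rw [h1] at hy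
          cases hy
        · rw [h2] at hy
          exact (Fin.castSucc_lt_last y).ne (Sum.inr_injective hy)
    · rw [← h2, f.injective.extend_apply, h2]
      simp

/-- Each NAND goes to a fresh ancilla, so no wire is ever overwritten. The register state `z` may
carry more than the program's input `ρ z`; the final ancilla contents depend on `ρ z` alone, which
later permits uncomputation after a qubit that the program does not read has been rotated. -/
theorem Reach.exists_circuit {R Z X : Type} [Fintype R] [DecidableEq R] (β : Z → R → Bool)
    (ρ : Z → X) {S : Set (X → Bool)}
    (hS : ∀ f ∈ S, f = (fun _ => false) ∨ ∃ r, ∀ z, β z r = f (ρ z)) {n : ℕ}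
    {S' : Set (X → Bool)} (h : Reach S n S') :
    ∃ (a : ℕ) (C : QCircuit (R ⊕ Fin a)) (g : X → Fin a → Bool), C.length ≤ 6 * n ∧ a ≤ n + 1 ∧
      (∀ z, act C (ket (Sum.elim (β z) fun _ => false)) = ket (Sum.elim (β z) (g (ρ z)))) ∧
      ∀ f ∈ S', ∃ q, ∀ z, Sum.elim (β z) (g (ρ z)) q = f (ρ z) := by
  induction h with
  | refl =>
    -- A spare ancilla, never written to, serves as the wire of the constant `false`; hence the
    -- bound `n + 1`.
    refine ⟨1, [], fun _ _ => false, by simp, by simp, fun z => by simp, fun f hf => ?_⟩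
    rcases hS f hf with rfl | ⟨r, hr⟩
    · exact ⟨Sum.inr 0, fun z => rfl⟩
    · exact ⟨Sum.inl r, hr⟩
  | weaken _ hnm ih =>
    obtain ⟨a, C, g, hC, ha, h⟩ := ih
    exact ⟨a, C, g, hC.trans (by omega), by omega, h⟩
  | @step n S' f₁ f₂ _ hf hg ih =>
    obtain ⟨a, C, g, hC, ha, hact, hw⟩ := ih
    obtain ⟨q₁, hq₁⟩ := hw _ hf
    obtain ⟨q₂, hq₂⟩ := hw _ hg
    set f := (Function.Embedding.refl R).sumMap (Fin.castSuccEmb (n := a)) with hfdef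
    have hlast : ∀ q, (Sum.inr (Fin.last a) : R ⊕ Fin (a + 1)) ≠ f q := by
      rintro (r | i) h
      · cases h
      · exact (Fin.castSucc_lt_last i).ne (Sum.inr_injective h).symm
    refine ⟨a + 1, circMap f C ++ nandCirc (f q₁) (f q₂) (Sum.inr (Fin.last a)) (hlast _)
      (hlast _), fun x => Fin.snoc (α := fun _ => Bool) (g x) (!(f₁ x && f₂ x)), ?_, by omega, ?_, ?_⟩
    · have := length_nandCirc (f q₁) (f q₂) (Sum.inr (Fin.last a)) (hlast _) (hlast _)
      simp only [List.length_append, length_circMap]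
      omega
    · intro z
      have h0 : (Sum.elim (β z) fun _ => false : R ⊕ Fin (a + 1) → Bool) =
          Function.extend f (Sum.elim (β z) fun _ => false) (fun _ => false) := by
        rw [hfdef, extend_snoc]
        congr 1
        ext i
        refine Fin.lastCases ?_ (fun i => ?_) i <;> simp
      have hk : ∀ y, ket (Function.extend f y fun _ => false) =
          embed (fun x => Function.extend f x fun _ => false) (ket y) := fun y =>
        (embed_single (fun x => Function.extend f x fun _ => false) y).symm
      rw [act_append, h0, hk, act_circMap, hact, embed_single, act_nandCirc,
        f.injective.extend_apply, f.injective.extend_apply, hq₁, hq₂, hfdef, extend_snoc]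
      · congr 1
        ext x
        rcases x with r | i
        · simp
        · refine Fin.lastCases ?_ (fun i => ?_) i
          · simp
          · rw [Function.update_of_ne]
            · simp
            · exact fun h => (Fin.castSucc_lt_last i).ne (Sum.inr_injective h)
      · rw [Function.extend_apply']
        rintro ⟨q, hq⟩
        exact hlast q hq.symm
    · intro h hh
      rcases hh with rfl | hh
      · exact ⟨Sum.inr (Fin.last a), fun z => by simp⟩
      · obtain ⟨q, hq⟩ := hw h hh
        refine ⟨f q, fun z => ?_⟩
        rw [← hq z]
        rcases q with r | i
        · rfl
        · exact Fin.snoc_castSucc (α := fun _ => Bool) _ _ i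

/-! ### Arithmetic by NAND gates -/

section Arithmetic

variable {X : Type*} {S T : Set (X → Bool)}

lemma Reach.subset {n : ℕ} {S' : Set (X → Bool)} (h : Reach S n S') : S ⊆ S' := by
  induction h with
  | refl => exact subset_rfl
  | step _ _ _ ih => exact ih.trans (Set.subset_insert _ _)
  | weaken _ _ ih => exact ih

lemma Reach.trans {n m : ℕ} {S' S'' : Set (X → Bool)} (h : Reach S n S') (h' : Reach S' m S'') :
    Reach S (n + m) S'' := by
  induction h' with
  | refl => exact h
  | step _ hf hg ih => exact .step ih hf hg
  | weaken _ hnm ih => exact .weaken ih (by omega)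

lemma Reach.mono {n : ℕ} {S' : Set (X → Bool)} (h : Reach S n S') (hST : S ⊆ T) :
    ∃ T', S' ⊆ T' ∧ Reach T n T' := by
  induction h with
  | refl => exact ⟨T, hST, .refl⟩
  | step _ hf hg ih =>
    obtain ⟨T', hT', h⟩ := ih
    exact ⟨_, Set.insert_subset_insert hT', .step h (hT' hf) (hT' hg)⟩
  | weaken _ hnm ih =>
    obtain ⟨T', hT', h⟩ := ih
    exact ⟨T', hT', .weaken h hnm⟩

/-- The Boolean function `f` is obtained from `S` with `n` gates. -/
def CompB (S : Set (X → Bool)) (n : ℕ) (f : X → Bool) : Prop := ∃ S', Reach S n S' ∧ f ∈ S'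

/-- All binary digits of `f` are in `S`. -/
def Has (S : Set (X → Bool)) (f : X → ℕ) : Prop := ∀ t, (fun x => (f x).testBit t) ∈ S

/-- The binary digits of `f` are obtained from `S` with `n` gates. -/
def CompN (S : Set (X → Bool)) (n : ℕ) (f : X → ℕ) : Prop := ∃ S', Reach S n S' ∧ Has S' f

/-- The constant functions are in `S`. -/
def Consts (S : Set (X → Bool)) : Prop := ∀ b : Bool, (fun _ => b) ∈ S

lemma Has.mono {f : X → ℕ} (h : Has S f) (hST : S ⊆ T) : Has T f := fun t => hST (h t)

lemma Consts.mono (h : Consts S) (hST : S ⊆ T) : Consts T := fun b => hST (h b)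

lemma Consts.has (h : Consts S) (n : ℕ) : Has S fun _ => n := fun _ => h _

lemma CompB.mono {n : ℕ} {f : X → Bool} (h : CompB S n f) (hST : S ⊆ T) : CompB T n f := by
  obtain ⟨S', h, hf⟩ := h
  obtain ⟨T', hT', h⟩ := h.mono hST
  exact ⟨T', h, hT' hf⟩

lemma CompN.mono {n : ℕ} {f : X → ℕ} (h : CompN S n f) (hST : S ⊆ T) : CompN T n f := by
  obtain ⟨S', h, hf⟩ := h
  obtain ⟨T', hT', h⟩ := h.mono hST
  exact ⟨T', h, hf.mono hT'⟩

lemma CompN.weaken {n m : ℕ} {f : X → ℕ} (h : CompN S n f) (hnm : n ≤ m) : CompN S m f := by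
  obtain ⟨S', h, hf⟩ := h
  exact ⟨S', h.weaken hnm, hf⟩

lemma CompB.of_mem {f : X → Bool} (h : f ∈ S) : CompB S 0 f := ⟨S, .refl, h⟩

lemma Has.comp {f : X → ℕ} (h : Has S f) : CompN S 0 f := ⟨S, .refl, h⟩

lemma CompB.pair {n m : ℕ} {f g : X → Bool} (hf : CompB S n f) (hg : CompB S m g) :
    ∃ S', Reach S (n + m) S' ∧ f ∈ S' ∧ g ∈ S' := by
  obtain ⟨S₁, h₁, hf⟩ := hf
  obtain ⟨S₂, h₂, hg⟩ := hg.mono h₁.subset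
  exact ⟨S₂, h₁.trans h₂, h₂.subset hf, hg⟩

lemma CompN.pair {n m : ℕ} {f g : X → ℕ} (hf : CompN S n f) (hg : CompN S m g) :
    ∃ S', Reach S (n + m) S' ∧ Has S' f ∧ Has S' g := by
  obtain ⟨S₁, h₁, hf⟩ := hf
  obtain ⟨S₂, h₂, hg⟩ := hg.mono h₁.subset
  exact ⟨S₂, h₁.trans h₂, hf.mono h₂.subset, hg⟩

lemma CompB.nand {n m : ℕ} {f g : X → Bool} (hf : CompB S n f) (hg : CompB S m g) :
    CompB S (n + m + 1) fun x => !(f x && g x) := by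
  obtain ⟨S', h, hf, hg⟩ := hf.pair hg
  exact ⟨_, .step h hf hg, Set.mem_insert _ _⟩

lemma CompB.not {n : ℕ} {f : X → Bool} (hf : CompB S n f) : CompB S (n + 1) fun x => !f x := by
  obtain ⟨S', h, hf⟩ := hf
  refine ⟨_, .step h hf hf, Or.inl ?_⟩
  simp

lemma CompB.and {n m : ℕ} {f g : X → Bool} (hf : CompB S n f) (hg : CompB S m g) :
    CompB S (n + m + 2) fun x => f x && g x := by
  simpa using (hf.nand hg).not

lemma CompB.or {n m : ℕ} {f g : X → Bool} (hf : CompB S n f) (hg : CompB S m g) :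
    CompB S (n + m + 3) fun x => f x || g x := by
  have := hf.not.nand hg.not
  simp only [Bool.not_and, Bool.not_not] at this
  obtain ⟨S', h, hf⟩ := this
  exact ⟨S', h.weaken (by omega), hf⟩

lemma CompB.xor {n m : ℕ} {f g : X → Bool} (hf : CompB S n f) (hg : CompB S m g) :
    CompB S (n + m + 5) fun x => f x ^^ g x := by
  obtain ⟨S₁, h₁, hf, hg⟩ := hf.pair hg
  have hf := CompB.of_mem hf
  have hg := CompB.of_mem hg
  obtain ⟨S₂, h₂, h⟩ := (hf.nand (hf.nand hg)).nand (hg.nand (hf.nand hg))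
  refine ⟨S₂, h₁.trans h₂, ?_⟩
  convert h using 2 with x
  cases f x <;> cases g x <;> rfl

lemma Reach.exists_forall_lt {c : ℕ} (w : ℕ) {h : ℕ → X → Bool} (hh : ∀ i < w, CompB S c (h i)) :
    ∃ S', Reach S (c * w) S' ∧ ∀ i < w, h i ∈ S' := by
  induction w with
  | zero => exact ⟨S, .refl, by simp⟩
  | succ w ih =>
    obtain ⟨S₁, h₁, hw⟩ := ih fun i hi => hh i (by omega)
    obtain ⟨S₂, h₂, h⟩ := (hh w (by omega)).mono h₁.subset
    refine ⟨S₂, (h₁.trans h₂).weaken (by rw [mul_add, mul_one]), fun i hi => ?_⟩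
    rcases Nat.lt_succ_iff_lt_or_eq.1 hi with hi | rfl
    · exact h₂.subset (hw i hi)
    · exact h

/-- Digits beyond the width are constantly `false`, so only `w` of them need gates. -/
lemma has_of_lt {f : X → ℕ} {w : ℕ} (hS : Consts S) (hf : ∀ x, f x < 2 ^ w)
    (h : ∀ i < w, (fun x => (f x).testBit i) ∈ S) : Has S f := by
  intro t
  rcases lt_or_ge t w with ht | ht
  · exact h t ht
  · have : (fun x => (f x).testBit t) = fun _ => false := by
      ext x
      exact Nat.testBit_lt_two_pow ((hf x).trans_le (Nat.pow_le_pow_right (by norm_num) ht))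
    rw [this]
    exact hS _

/-- Ripple-carry addition: the two XORs of a sum bit cost 10 gates and the majority that forms the
next carry costs 12. -/
lemma Has.add {f g : X → ℕ} (hS : Consts S) (hf : Has S f) (hg : Has S g) (w : ℕ)
    (hfg : ∀ x, f x + g x < 2 ^ w) : CompN S (22 * w) fun x => f x + g x := by
  set c : ℕ → X → Bool := fun i x =>
    BitVec.carry i (BitVec.ofNat w (f x)) (BitVec.ofNat w (g x)) false with hc
  have key : ∀ v ≤ w, ∃ S', Reach S (22 * v) S' ∧ c v ∈ S' ∧
      ∀ i < v, (fun x => (f x + g x).testBit i) ∈ S' := by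
    intro v
    induction v with
    | zero =>
      intro _
      refine ⟨S, .refl, ?_, by simp⟩
      simpa [hc] using hS false
    | succ v ih =>
      intro hv
      obtain ⟨S₁, h₁, hcv, hi⟩ := ih (by omega)
      have hfv := CompB.of_mem (h₁.subset (hf v))
      have hgv := CompB.of_mem (h₁.subset (hg v))
      have hcv := CompB.of_mem hcv
      obtain ⟨S₂, h₂, hx, hm⟩ := (hfv.xor (hgv.xor hcv)).pair
        (((hfv.and hgv).or (hfv.and hcv)).or (hgv.and hcv))
      refine ⟨S₂, (h₁.trans h₂).weaken (by omega), ?_, fun i hi' => ?_⟩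
      · convert hm using 2 with x
        simp only [hc]
        rw [BitVec.carry_succ]
        rw [BitVec.getLsbD_ofNat, BitVec.getLsbD_ofNat]
        simp [show v < w by omega, Bool.atLeastTwo]
      · rcases Nat.lt_succ_iff_lt_or_eq.1 hi' with hi' | rfl
        · exact h₂.subset (hi i hi')
        · convert hx using 2 with x
          have := BitVec.getLsbD_add (show i < w by omega) (BitVec.ofNat w (f x))
            (BitVec.ofNat w (g x))
          rw [← BitVec.ofNat_add, BitVec.getLsbD_ofNat, BitVec.getLsbD_ofNat,
            BitVec.getLsbD_ofNat] at this
          simpa [show i < w by omega] using this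
  obtain ⟨S', h, -, hS'⟩ := key w le_rfl
  exact ⟨S', h, has_of_lt (hS.mono h.subset) hfg hS'⟩

/-- A bound for the number of gates of an arithmetic operation on numbers of `w` bits. -/
def opCost (w : ℕ) : ℕ := 50 * (w + 1) ^ 2

lemma CompN.add {n m w : ℕ} {f g : X → ℕ} (hS : Consts S) (hf : CompN S n f) (hg : CompN S m g)
    (hfg : ∀ x, f x + g x < 2 ^ w) : CompN S (n + m + opCost w) fun x => f x + g x := by
  obtain ⟨S₁, h₁, hf, hg⟩ := hf.pair hg
  obtain ⟨S₂, h₂, h⟩ := hf.add (hS.mono h₁.subset) hg w hfg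
  exact ⟨S₂, (h₁.trans h₂).weaken (by unfold opCost; nlinarith), h⟩

/-- Two's complement: the bitwise negation of g is 2^w - 1 - g, so f + (2^w - 1 - g) + 1 = 2^w + (f
- g) over the integers. Its bit `w` is set exactly when g ≤ f; masking with that bit yields the
truncated subtraction of `ℕ`. -/
lemma CompN.sub {n m w : ℕ} {f g : X → ℕ} (hS : Consts S) (hf : CompN S n f) (hg : CompN S m g)
    (hf' : ∀ x, f x < 2 ^ w) (hg' : ∀ x, g x < 2 ^ w) :
    CompN S (n + m + opCost w) fun x => f x - g x := by
  obtain ⟨S₁, h₁, hf, hg⟩ := hf.pair hg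
  have hS₁ := hS.mono h₁.subset
  obtain ⟨S₂, h₂, h⟩ := Reach.exists_forall_lt (S := S₁) (c := 1) w
    (h := fun i x => !(g x).testBit i) fun i _ => (CompB.of_mem (hg i)).not
  have hS₂ := hS₁.mono h₂.subset
  have hc : Has S₂ fun x => 2 ^ w - (g x + 1) := by
    refine has_of_lt (w := w) hS₂ (fun x => ?_) fun i hi => ?_
    · have := hg' x
      omega
    · simpa [Nat.testBit_two_pow_sub_succ (hg' _), hi] using h i hi
  have hp : 2 ^ (w + 1) = 2 * 2 ^ w := by ring
  have hw := Nat.one_le_two_pow (n := w)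
  obtain ⟨S₃, h₃, hs⟩ := (hf.mono h₂.subset).add hS₂ hc (w + 1) fun x => by
    have := hf' x
    have := hg' x
    omega
  have hS₃ := hS₂.mono h₃.subset
  obtain ⟨S₄, h₄, hu⟩ := hs.add hS₃ (hS₃.has 1) (w + 1) fun x => by
    have := hf' x
    have := hg' x
    omega
  obtain ⟨S₅, h₅, hr⟩ := Reach.exists_forall_lt (S := S₄) (c := 2) w
    (h := fun i x => (f x + (2 ^ w - (g x + 1)) + 1).testBit i &&
      (f x + (2 ^ w - (g x + 1)) + 1).testBit w)
    fun i _ => (CompB.of_mem (hu i)).and (CompB.of_mem (hu w))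
  refine ⟨S₅, ((((h₁.trans h₂).trans h₃).trans h₄).trans h₅).weaken
    (by unfold opCost; nlinarith), ?_⟩
  refine has_of_lt (w := w) (((hS₃.mono h₄.subset)).mono h₅.subset)
    (fun x => (Nat.sub_le _ _).trans_lt (hf' x)) fun i hi => ?_
  convert hr i hi using 2 with x
  have h1 := hf' x
  have h2 := hg' x
  rcases le_or_gt (g x) (f x) with hle | hlt
  · have e : f x + (2 ^ w - (g x + 1)) + 1 = 2 ^ w + (f x - g x) := by omega
    rw [e, Nat.testBit_two_pow_add_gt hi, Nat.testBit_two_pow_add_eq,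
      Nat.testBit_lt_two_pow (show f x - g x < 2 ^ w by omega)]
    simp
  · have e : f x - g x = 0 := by omega
    rw [e, Nat.testBit_lt_two_pow (show f x + (2 ^ w - (g x + 1)) + 1 < 2 ^ w by omega)]
    simp

/-- Schoolbook multiplication: round `v` adds the shift of f by `v`, masked by bit `v` of g.
Shifting is mere rewiring, masking costs 2w gates and the addition 22w. -/
lemma CompN.mul {n m w : ℕ} {f g : X → ℕ} (hS : Consts S) (hf : CompN S n f) (hg : CompN S m g)
    (hg' : ∀ x, g x < 2 ^ w) (hfg : ∀ x, f x * g x < 2 ^ w) :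
    CompN S (n + m + opCost w) fun x => f x * g x := by
  obtain ⟨S₁, h₁, hf, hg⟩ := hf.pair hg
  have hS₁ := hS.mono h₁.subset
  have hstep : ∀ v x, f x * (g x % 2 ^ (v + 1)) =
      f x * (g x % 2 ^ v) + 2 ^ v * (f x * ((g x).testBit v).toNat) := by
    intro v x
    rw [Nat.toNat_testBit, Nat.mod_pow_succ]
    ring
  have key : ∀ v ≤ w, CompN S₁ (24 * w * v) fun x => f x * (g x % 2 ^ v) := by
    intro v
    induction v with
    | zero =>
      intro _
      simpa [Nat.mod_one] using (hS₁.has 0).comp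
    | succ v ih =>
      intro hv
      obtain ⟨S₂, h₂, hp⟩ := ih (by omega)
      have hS₂ := hS₁.mono h₂.subset
      have hlt : ∀ x, f x * (g x % 2 ^ (v + 1)) < 2 ^ w := fun x =>
        (Nat.mul_le_mul_left _ (Nat.mod_le _ _)).trans_lt (hfg x)
      obtain ⟨S₃, h₃, hm⟩ := Reach.exists_forall_lt (S := S₂) (c := 2) w
        (h := fun i x => (decide (i ≥ v) && (f x).testBit (i - v)) && (g x).testBit v) fun i _ => by
          refine CompB.and (n := 0) (m := 0) (.of_mem ?_) (.of_mem (h₂.subset (hg v)))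
          by_cases hi : i ≥ v
          · simpa [hi] using h₂.subset (hf (i - v))
          · simpa [hi] using hS₂ false
      have hS₃ := hS₂.mono h₃.subset
      have hmask : Has S₃ fun x => 2 ^ v * (f x * ((g x).testBit v).toNat) := by
        refine has_of_lt (w := w) hS₃ (fun x => ?_) fun i hi => ?_
        · have := hlt x
          rw [hstep] at this
          omega
        · convert hm i hi using 2 with x
          rw [Nat.testBit_two_pow_mul]
          cases (g x).testBit v <;> simp
      obtain ⟨S₄, h₄, hr⟩ := (hp.mono h₃.subset).add hS₃ hmask w fun x => by
        rw [← hstep]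
        exact hlt x
      refine ⟨S₄, ((h₂.trans h₃).trans h₄).weaken (by nlinarith), ?_⟩
      convert hr using 2 with x
      exact hstep v x
  obtain ⟨S₂, h₂, h⟩ := key w le_rfl
  refine ⟨S₂, (h₁.trans h₂).weaken (by unfold opCost; nlinarith), ?_⟩
  convert h using 2 with x
  rw [Nat.mod_eq_of_lt (hg' x)]

/-! ### Boolean circuits as subroutines -/

/-- The constants are required because missing wires read as `false`. -/
lemma Reach.runNand (gates : List (ℕ × ℕ)) (fs : List (X → Bool)) (hfs : ∀ f ∈ fs, f ∈ S)
    (hS : Consts S) : ∃ S', Reach S gates.length S' ∧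
      ∀ t, (fun x => (runNand gates (fs.map fun f => f x)).getD t false) ∈ S' := by
  have hget : ∀ (T : Set (X → Bool)) (l : List (X → Bool)), (∀ f ∈ l, f ∈ T) → Consts T →
      ∀ t, (fun x => (l.map fun f => f x).getD t false) ∈ T := by
    intro T l hl hT t
    rcases lt_or_ge t l.length with h | h
    · have : (fun x => (l.map fun f => f x).getD t false) = l[t] := by
        ext x
        simp [List.getD, h]
      rw [this]
      exact hl _ (List.getElem_mem h)
    · have : (fun x => (l.map fun f => f x).getD t false) = fun _ => false := by
        ext x
        simp [List.getD, h]
      rw [this]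
      exact hT _
  induction gates generalizing S fs with
  | nil => exact ⟨S, .refl, hget S fs hfs hS⟩
  | cons g gates ih =>
    have h₁ := Reach.step .refl (hget S fs hfs hS g.1) (hget S fs hfs hS g.2)
    obtain ⟨S', h, hS'⟩ := ih (fs ++ [fun x => !((fs.map fun f => f x).getD g.1 false &&
      (fs.map fun f => f x).getD g.2 false)]) (by
        intro f hf
        rcases List.mem_append.1 hf with hf | hf
        · exact h₁.subset (hfs f hf)
        · rw [List.mem_singleton] at hf
          exact Or.inl hf) (hS.mono h₁.subset)
    refine ⟨S', (h₁.trans h).weaken (by simp; omega), fun t => ?_⟩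
    simpa [SzegedyWalk.runNand] using hS' t

lemma sum_toNat_eq_ofBits {o : ℕ} (b : Fin o → Bool) :
    ∑ t : Fin o, (b t).toNat * 2 ^ (t : ℕ) = Nat.ofBits b := by
  induction o with
  | zero => simp [Nat.ofBits]
  | succ o ih =>
    rw [Fin.sum_univ_succ, Nat.ofBits_succ, ← ih, Finset.mul_sum]
    simp only [Fin.val_zero, pow_zero, mul_one, Fin.val_succ, Function.comp]
    rw [add_comm]
    congr 1
    exact Finset.sum_congr rfl fun t _ => by ring

lemma CompN.eval {o n m : ℕ} (C : BoolCircuit o) (w : ℕ) {f g : X → ℕ} (hS : Consts S)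
    (hf : CompN S n f) (hg : CompN S m g) :
    CompN S (n + m + C.gates.length) fun x => C.eval (bits w (f x) ++ bits w (g x)) := by
  obtain ⟨S₁, h₁, hf, hg⟩ := hf.pair hg
  obtain ⟨S₂, h₂, h⟩ := Reach.runNand (S := S₁) C.gates
    ((List.range w).map (fun t x => (f x).testBit t) ++
      (List.range w).map (fun t x => (g x).testBit t)) (by
        intro φ hφ
        rcases List.mem_append.1 hφ with hφ | hφ <;> obtain ⟨t, -, rfl⟩ := List.mem_map.1 hφ
        exacts [hf t, hg t]) (hS.mono h₁.subset)
  refine ⟨S₂, h₁.trans h₂, fun t => ?_⟩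
  simp only [BoolCircuit.eval, sum_toNat_eq_ofBits]
  rcases lt_or_ge t o with ht | ht
  · simpa [Nat.testBit_ofBits_lt _ _ ht, bits, Function.comp_def] using h (C.out ⟨t, ht⟩)
  · simpa [Nat.testBit_ofBits_ge _ _ ht] using (hS.mono h₁.subset).mono h₂.subset false

end Arithmetic

/-! ### Rotation angles from integer weights -/

/-- The decision whether the vector `(x, y)` may be rotated by `arctan 2⁻ᵗ` without passing the
direction of `(√A, √B)`. -/
def cordicBit (A B t x y : ℕ) : ℕ :=
  1 - (A * ((2 ^ t * y + x) * (2 ^ t * y + x)) - B * ((2 ^ t * x - y) * (2 ^ t * x - y)))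

/-- The successive vectors on the way from `(1, 0)` to the direction of `(√A, √B)`. -/
def cordic (A B : ℕ) : ℕ → ℕ × ℕ
  | 0 => (1, 0)
  | t + 1 =>
    let z := cordic A B t
    let b := cordicBit A B t z.1 z.2
    (b * (2 ^ t * z.1 - z.2) + (1 - b) * (2 ^ t * z.1),
      b * (2 ^ t * z.2 + z.1) + (1 - b) * (2 ^ t * z.2))

/-- The digits of the angle of `(√A, √B)` with respect to the angles `arctan 2⁻ᵗ`. -/
def cordicDigit (A B t : ℕ) : ℕ := cordicBit A B t (cordic A B t).1 (cordic A B t).2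

/-- The angle given by the first `t` digits. -/
def cordicAngle (A B t : ℕ) : ℝ :=
  ∑ s ∈ Finset.range t, (cordicDigit A B s : ℝ) * Real.arctan ((1 / 2) ^ s)

/-- 1 - (a - b) with truncated subtractions decides a ≤ b, so the comparison too is done by the
arithmetic circuits. -/
lemma cordicBit_eq (A B t x y : ℕ) : cordicBit A B t x y =
    if A * ((2 ^ t * y + x) * (2 ^ t * y + x)) ≤ B * ((2 ^ t * x - y) * (2 ^ t * x - y))
    then 1 else 0 := by
  unfold cordicBit
  split_ifs <;> omega

lemma cordicDigit_le_one (A B t : ℕ) : cordicDigit A B t ≤ 1 := Nat.sub_le _ _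

/-- Rotations are scaled by 2^t to stay within the integers and the vector is never renormalized, as
only its direction matters. The price is a factor of at most 2^t + 1 per step, so the coordinates
keep polynomially many bits. -/
lemma cordic_le {A B t K : ℕ} (ht : t ≤ K) :
    (cordic A B t).1 ≤ 2 ^ (t * (K + 1)) ∧ (cordic A B t).2 ≤ 2 ^ (t * (K + 1)) := by
  induction t with
  | zero => simp [cordic]
  | succ t ih =>
    obtain ⟨hx, hy⟩ := ih (by omega)
    have hK : 2 ^ t + 1 ≤ 2 ^ (K + 1) := by
      have : 2 ^ t ≤ 2 ^ K := Nat.pow_le_pow_right (by norm_num) (by omega)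
      have := Nat.one_le_two_pow (n := K)
      rw [pow_succ]
      omega
    have hpow : 2 ^ ((t + 1) * (K + 1)) = 2 ^ (K + 1) * 2 ^ (t * (K + 1)) := by
      rw [← pow_add]
      congr 1
      ring
    have h1 : ∀ x ≤ 2 ^ (t * (K + 1)), ∀ y ≤ 2 ^ (t * (K + 1)),
        2 ^ t * y + x ≤ 2 ^ ((t + 1) * (K + 1)) := by
      intro x hx y hy
      rw [hpow]
      calc 2 ^ t * y + x ≤ 2 ^ t * 2 ^ (t * (K + 1)) + 2 ^ (t * (K + 1)) := by gcongr
        _ = (2 ^ t + 1) * 2 ^ (t * (K + 1)) := by ring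
        _ ≤ _ := by gcongr
    have h2 := h1 _ hx _ hy
    have h3 := h1 0 (by positivity) _ hx
    have h4 := h1 0 (by positivity) _ hy
    simp only [cordic, cordicBit_eq]
    split_ifs
    · constructor <;> omega
    · constructor <;> omega

/-- The width allows for the largest number that occurs: a coordinate of about (K + 1)² bits is
squared and multiplied by a weight of `L` bits. A digit takes 18 operations: 4 for the rotated
vector, 6 for the test and 4 to select each new coordinate. -/
lemma exists_reach_cordic {X : Type*} {S : Set (X → Bool)} (hS : Consts S) {A B : X → ℕ}
    (hA : Has S A) (hB : Has S B) {L : ℕ} (hL : 0 < L) (hAL : ∀ i, A i < 2 ^ L)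
    (hBL : ∀ i, B i < 2 ^ L) (K : ℕ) {v : ℕ} (hv : v ≤ K) :
    ∃ S', Reach S (18 * opCost (2 * (K + 1) ^ 2 + L) * v) S' ∧
      Has S' (fun i => (cordic (A i) (B i) v).1) ∧ Has S' (fun i => (cordic (A i) (B i) v).2) ∧
      ∀ t < v, Has S' fun i => cordicDigit (A i) (B i) t := by
  set w := 2 * (K + 1) ^ 2 + L with hw
  induction v with
  | zero => exact ⟨S, .refl, hS.has 1, hS.has 0, by simp⟩
  | succ v ih =>
    obtain ⟨S₁, h₁, hx, hy, hd⟩ := ih (by omega)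
    have hS₁ := hS.mono h₁.subset
    have hb := fun i => cordic_le (A := A i) (B := B i) (t := v) (K := K) (by omega)
    set x := fun i => (cordic (A i) (B i) v).1 with hxdef
    set y := fun i => (cordic (A i) (B i) v).2 with hydef
    set D := (K + 1) ^ 2 with hD
    have hDw : 2 ^ D < 2 ^ w := Nat.pow_lt_pow_right (by norm_num) (by omega)
    have h2v : 2 ^ v + 1 ≤ 2 ^ (K + 1) := by
      have : 2 ^ v ≤ 2 ^ K := Nat.pow_le_pow_right (by norm_num) (by omega)
      have := Nat.one_le_two_pow (n := K)
      rw [pow_succ]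
      omega
    have hsum : ∀ a ≤ 2 ^ (v * (K + 1)), ∀ b ≤ 2 ^ (v * (K + 1)), 2 ^ v * b + a ≤ 2 ^ D := by
      intro a ha b hb
      calc 2 ^ v * b + a ≤ 2 ^ v * 2 ^ (v * (K + 1)) + 2 ^ (v * (K + 1)) := by gcongr
        _ = (2 ^ v + 1) * 2 ^ (v * (K + 1)) := by ring
        _ ≤ 2 ^ (K + 1) * 2 ^ (v * (K + 1)) := by gcongr
        _ = 2 ^ ((v + 1) * (K + 1)) := by rw [← pow_add]; congr 1; ring
        _ ≤ _ := Nat.pow_le_pow_right (by norm_num) (by rw [hD, sq]; gcongr; omega)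
    have hu : ∀ i, 2 ^ v * y i + x i ≤ 2 ^ D := fun i => hsum _ (hb i).1 _ (hb i).2
    have hx2 : ∀ i, 2 ^ v * x i ≤ 2 ^ D := fun i => hsum 0 (by positivity) _ (hb i).1
    have hy2 : ∀ i, 2 ^ v * y i ≤ 2 ^ D := fun i => hsum 0 (by positivity) _ (hb i).2
    have hmul : ∀ a b : ℕ, a < 2 ^ L → b ≤ 2 ^ D → b * b < 2 ^ w ∧ a * (b * b) < 2 ^ w := by
      intro a b ha hb
      have h1 : b * b ≤ 2 ^ (2 * D) := by
        calc b * b ≤ 2 ^ D * 2 ^ D := Nat.mul_le_mul hb hb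
          _ = _ := by rw [← pow_add, two_mul]
      have h2 : 2 ^ w = 2 ^ L * 2 ^ (2 * D) := by rw [hw, ← pow_add, add_comm]
      refine ⟨h1.trans_lt (Nat.pow_lt_pow_right (by norm_num) (by omega)), ?_⟩
      calc a * (b * b) ≤ a * 2 ^ (2 * D) := Nat.mul_le_mul_left _ h1
        _ < _ := by
          rw [h2]
          exact Nat.mul_lt_mul_of_pos_right ha (by positivity)
    have hxw : ∀ i, x i < 2 ^ w := fun i => lt_of_le_of_lt
      ((Nat.le_mul_of_pos_left _ (by positivity)).trans (hx2 i)) hDw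
    have hyw : ∀ i, y i < 2 ^ w := fun i => lt_of_le_of_lt
      ((Nat.le_mul_of_pos_left _ (by positivity)).trans (hy2 i)) hDw
    have hx2w : ∀ i, 2 ^ v * x i < 2 ^ w := fun i => (hx2 i).trans_lt hDw
    have hy2w : ∀ i, 2 ^ v * y i < 2 ^ w := fun i => (hy2 i).trans_lt hDw
    obtain ⟨S₂, h₂, hX2, hY2⟩ := ((((hS₁.has (2 ^ v)).comp).mul (w := w) hS₁ hx.comp hxw hx2w).pair
      (((hS₁.has (2 ^ v)).comp).mul (w := w) hS₁ hy.comp hyw hy2w))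
    have hS₂ := hS₁.mono h₂.subset
    obtain ⟨S₃, h₃, hU, hV⟩ := (hY2.comp.add (w := w) hS₂ (hx.mono h₂.subset).comp
      fun i => (hu i).trans_lt hDw).pair
      (hX2.comp.sub (w := w) hS₂ (hy.mono h₂.subset).comp hx2w hyw)
    have hS₃ := hS₂.mono h₃.subset
    have hv2 : ∀ i, 2 ^ v * x i - y i ≤ 2 ^ D := fun i => (Nat.sub_le _ _).trans (hx2 i)
    have hA₃ := ((hA.mono h₁.subset).mono h₂.subset).mono h₃.subset
    have hB₃ := ((hB.mono h₁.subset).mono h₂.subset).mono h₃.subset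
    obtain ⟨S₄, h₄, hbit⟩ := ((hS₃.has 1).comp).sub (w := w) hS₃
      ((hA₃.comp.mul (w := w) hS₃ (hU.comp.mul (w := w) hS₃ hU.comp
          (fun i => (hu i).trans_lt hDw) fun i => (hmul _ _ (hAL i) (hu i)).1)
          (fun i => (hmul _ _ (hAL i) (hu i)).1) fun i => (hmul _ _ (hAL i) (hu i)).2).sub (w := w) hS₃
        (hB₃.comp.mul (w := w) hS₃ (hV.comp.mul (w := w) hS₃ hV.comp
          (fun i => (hv2 i).trans_lt hDw) fun i => (hmul _ _ (hBL i) (hv2 i)).1)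
          (fun i => (hmul _ _ (hBL i) (hv2 i)).1) fun i => (hmul _ _ (hBL i) (hv2 i)).2)
        (fun i => (hmul _ _ (hAL i) (hu i)).2) fun i => (hmul _ _ (hBL i) (hv2 i)).2)
      (fun i => Nat.one_lt_two_pow (by omega))
      (fun i => (Nat.sub_le _ _).trans_lt (hmul _ _ (hAL i) (hu i)).2)
    have hS₄ := hS₃.mono h₄.subset
    have hbit' : Has S₄ fun i => cordicDigit (A i) (B i) v := hbit
    have hbit01 : ∀ i, cordicDigit (A i) (B i) v = 0 ∨ cordicDigit (A i) (B i) v = 1 := fun i => by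
      have := cordicDigit_le_one (A i) (B i) v
      omega
    have hsel : ∀ (p q : X → ℕ), Has S₄ p → Has S₄ q → (∀ i, p i < 2 ^ w) → (∀ i, q i < 2 ^ w) →
        CompN S₄ (4 * opCost w) fun i => cordicDigit (A i) (B i) v * p i +
          (1 - cordicDigit (A i) (B i) v) * q i := by
      intro p q hp hq hpw hqw
      have h1w : 1 < 2 ^ w := Nat.one_lt_two_pow (by omega)
      refine ((hbit'.comp.mul (w := w) hS₄ hp.comp hpw fun i => ?_).add (w := w) hS₄
        ((((hS₄.has 1).comp).sub (w := w) hS₄ hbit'.comp (fun _ => h1w) fun i => ?_).mul (w := w) hS₄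
          hq.comp hqw fun i => ?_) fun i => ?_).weaken (by omega)
      · rcases hbit01 i with h | h <;> simp [h, hpw i]
      · rcases hbit01 i with h | h <;> simp [h]; omega
      · rcases hbit01 i with h | h <;> simp [h, hqw i]
      · rcases hbit01 i with h | h <;> simp [h, hpw i, hqw i]
    obtain ⟨S₅, h₅, hx', hy'⟩ := (hsel _ _ (hV.mono h₄.subset)
      ((hX2.mono h₃.subset).mono h₄.subset) (fun i => (hv2 i).trans_lt hDw) hx2w).pair
      (hsel _ _ (hU.mono h₄.subset)
      ((hY2.mono h₃.subset).mono h₄.subset) (fun i => (hu i).trans_lt hDw) hy2w)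
    refine ⟨S₅, ((((h₁.trans h₂).trans h₃).trans h₄).trans h₅).weaken ?_, hx', hy', fun t ht => ?_⟩
    · rw [mul_add, mul_one]
      omega
    · rcases Nat.lt_succ_iff_lt_or_eq.1 ht with ht | rfl
      · exact (((((hd t ht).mono h₂.subset).mono h₃.subset).mono h₄.subset).mono h₅.subset)
      · exact hbit'.mono h₅.subset

/-! ### Convergence of the angle digits and accuracy of the split amplitudes -/

lemma arctan_half_pow_le (t : ℕ) :
    Real.arctan ((1 / 2) ^ t) ≤ 2 * Real.arctan ((1 / 2) ^ (t + 1)) := by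
  have h0 : (0 : ℝ) < (1 / 2) ^ (t + 1) := by positivity
  have h1 : ((1 : ℝ) / 2) ^ (t + 1) < 1 := pow_lt_one₀ (by norm_num) (by norm_num) (by omega)
  rw [Real.two_mul_arctan (by linarith) h1]
  refine Real.arctan_mono ?_
  rw [le_div_iff₀ (by nlinarith)]
  have : ((1 : ℝ) / 2) ^ t = 2 * (1 / 2) ^ (t + 1) := by rw [pow_succ]; ring
  rw [this]
  nlinarith [sq_nonneg (((1 : ℝ) / 2) ^ (t + 1))]

/-- Let θs be the target angle, θ the current one and α = arctan 2⁻ᵗ. The test compares A sin² with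
B cos² at θ + α, which in the first quadrant decides θ + α ≤ θs. If the rotation is accepted, the
remainder falls from at most 2α to at most α; if it is rejected, the remainder was already at most
α. By `arctan_half_pow_le`, α is at most twice the next angle, so the invariant persists. It starts
with θs ≤ π/2 = 2 arctan 1. -/
lemma cordic_spec {A B : ℕ} (hA : 0 < A) (t : ℕ) :
    0 ≤ cordicAngle A B t ∧
    cordicAngle A B t ≤ Real.arccos √(A / (A + B)) ∧
    Real.arccos √(A / (A + B)) - cordicAngle A B t ≤ 2 * Real.arctan ((1 / 2) ^ t) ∧
    ∃ g : ℝ, 0 < g ∧ ((cordic A B t).1 : ℝ) = g * Real.cos (cordicAngle A B t) ∧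
      ((cordic A B t).2 : ℝ) = g * Real.sin (cordicAngle A B t) := by
  set θs := Real.arccos √(A / (A + B)) with hθs
  have hA' : (0 : ℝ) < A := by exact_mod_cast hA
  have hB' : (0 : ℝ) ≤ B := by positivity
  have hθs2 : θs ≤ Real.pi / 2 := Real.arccos_le_pi_div_two.2 (Real.sqrt_nonneg _)
  induction t with
  | zero =>
    refine ⟨by simp [cordicAngle], by simpa [cordicAngle] using Real.arccos_nonneg _, ?_, 1, one_pos,
      by simp [cordic, cordicAngle], by simp [cordic, cordicAngle]⟩
    simp only [cordicAngle, Finset.range_zero, Finset.sum_empty, pow_zero, Real.arctan_one]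
    linarith
  | succ t ih =>
    obtain ⟨h0, hle, hge, g, hg, hx, hy⟩ := ih
    set θ := cordicAngle A B t with hθ
    set α := Real.arctan ((1 / 2) ^ t) with hα
    have hα0 : 0 < α := Real.arctan_pos.2 (by positivity)
    have hα2 : α < Real.pi / 2 := Real.arctan_lt_pi_div_two _
    have hc : 0 < Real.cos α := Real.cos_arctan_pos _
    have hs : 2 ^ t * Real.sin α = Real.cos α := by
      have := Real.tan_arctan ((1 / 2) ^ t)
      rw [← hα, Real.tan_eq_sin_div_cos, div_eq_iff hc.ne'] at this
      rw [this, ← mul_assoc, ← mul_pow]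
      norm_num
    have hstep := arctan_half_pow_le t
    rw [← hα] at hstep
    have hangle : cordicAngle A B (t + 1) = θ + cordicDigit A B t * α := by
      rw [cordicAngle, Finset.sum_range_succ]
      rfl
    set x := (cordic A B t).1 with hxd
    set y := (cordic A B t).2 with hyd
    -- The length after rotating: (2^t x - y, 2^t y + x) is (x, y) turned by α and stretched by 2^t
    -- / cos α.
    set g' := g * 2 ^ t / Real.cos α with hg'
    have hg'0 : 0 < g' := by positivity
    have hu : (2 : ℝ) ^ t * y + x = g' * Real.sin (θ + α) := by
      rw [hx, hy, hg', Real.sin_add, div_mul_eq_mul_div, eq_div_iff hc.ne']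
      linear_combination -(g * Real.cos θ) * hs
    have hv : (2 : ℝ) ^ t * x - y = g' * Real.cos (θ + α) := by
      rw [hx, hy, hg', Real.cos_add, div_mul_eq_mul_div, eq_div_iff hc.ne']
      linear_combination (g * Real.sin θ) * hs
    have hsin : 0 < Real.sin (θ + α) := Real.sin_pos_of_pos_of_lt_pi (by linarith) (by linarith)
    have hcs := Real.sin_sq_add_cos_sq (θ + α)
    have hq : ∀ c : ℝ, 0 ≤ c → (√(A / (A + B)) ≤ c ↔ A ≤ (A + B) * c ^ 2) := by
      intro c hc
      rw [Real.sqrt_le_left hc, div_le_iff₀ (by positivity), mul_comm]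
    have harc : Real.arccos (Real.cos (θ + α)) = θ + α :=
      Real.arccos_cos (by linarith) (by linarith)
    have hstep1 : cordic A B (t + 1) = (cordicDigit A B t * (2 ^ t * x - y) +
      (1 - cordicDigit A B t) * (2 ^ t * x), cordicDigit A B t * (2 ^ t * y + x) +
      (1 - cordicDigit A B t) * (2 ^ t * y)) := rfl
    have hdig : cordicDigit A B t = _ := cordicBit_eq A B t x y
    have huN : ((2 ^ t * y + x : ℕ) : ℝ) = g' * Real.sin (θ + α) := by
      rw [← hu]
      push_cast
      rfl
    have hvN : y ≤ 2 ^ t * x → ((2 ^ t * x - y : ℕ) : ℝ) = g' * Real.cos (θ + α) := by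
      intro h
      rw [← hv, Nat.cast_sub h]
      push_cast
      rfl
    split_ifs at hdig with hacc
    · rw [hangle, hstep1, hdig]
      simp only [Nat.cast_one, one_mul, Nat.sub_self, zero_mul, add_zero]
      -- Past the right angle the truncated difference is 0, and A > 0 makes the test fail.
      -- Acceptance therefore excludes this case, and the natural subtraction is a true one.
      have hlt : y < 2 ^ t * x := by
        by_contra hcon
        rw [Nat.sub_eq_zero_of_le (by omega)] at hacc
        have hpos : (0 : ℝ) < ((2 ^ t * y + x : ℕ) : ℝ) := by
          rw [huN]
          positivity
        have hpos : 0 < 2 ^ t * y + x := by exact_mod_cast hpos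
        have : 0 < A * ((2 ^ t * y + x) * (2 ^ t * y + x)) := by positivity
        omega
      have hvN := hvN hlt.le
      have hcos : 0 < Real.cos (θ + α) := by
        have : (0 : ℝ) < ((2 ^ t * x - y : ℕ) : ℝ) := by exact_mod_cast Nat.sub_pos_of_lt hlt
        rw [hvN] at this
        exact (pos_iff_pos_of_mul_pos this).1 hg'0
      have hacc' : (A : ℝ) * (g' * Real.sin (θ + α) * (g' * Real.sin (θ + α))) ≤
          B * (g' * Real.cos (θ + α) * (g' * Real.cos (θ + α))) := by
        rw [← huN, ← hvN]
        exact_mod_cast hacc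
      have hacc2 : (A : ℝ) * Real.sin (θ + α) ^ 2 ≤ B * Real.cos (θ + α) ^ 2 := by
        have : g' ^ 2 * (A * Real.sin (θ + α) ^ 2) ≤ g' ^ 2 * (B * Real.cos (θ + α) ^ 2) := by
          linarith
        exact le_of_mul_le_mul_left this (by positivity)
      have hle' : θ + α ≤ θs := by
        rw [← harc]
        refine Real.arccos_le_arccos ((hq _ hcos.le).2 ?_)
        nlinarith
      exact ⟨by linarith, hle', by linarith, g', hg'0, hvN, huN⟩
    · rw [hangle, hstep1, hdig]
      simp only [Nat.cast_zero, zero_mul, add_zero, zero_add, Nat.sub_zero, one_mul]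
      refine ⟨h0, hle, ?_, 2 ^ t * g, by positivity, ?_, ?_⟩
      · suffices h : θs ≤ θ + α by linarith
        -- A negative cosine puts θ + α beyond π/2, hence beyond θs; otherwise the failed test is
        -- genuine.
        rcases lt_or_ge (Real.cos (θ + α)) 0 with hneg | hcos
        · by_contra hcon
          exact absurd (Real.cos_nonneg_of_neg_pi_div_two_le_of_le (by linarith)
            (by linarith : θ + α ≤ Real.pi / 2)) (by linarith)
        · have hle2 : y ≤ 2 ^ t * x := by
            have : (0 : ℝ) ≤ 2 ^ t * x - y := by
              rw [hv]
              positivity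
            have : (y : ℝ) ≤ 2 ^ t * x := by linarith
            exact_mod_cast this
          have hvN := hvN hle2
          have hacc' : B * (g' * Real.cos (θ + α) * (g' * Real.cos (θ + α))) <
              (A : ℝ) * (g' * Real.sin (θ + α) * (g' * Real.sin (θ + α))) := by
            rw [← huN, ← hvN]
            exact_mod_cast not_le.1 hacc
          have hacc2 : (B : ℝ) * Real.cos (θ + α) ^ 2 < A * Real.sin (θ + α) ^ 2 := by
            have : g' ^ 2 * (B * Real.cos (θ + α) ^ 2) < g' ^ 2 * (A * Real.sin (θ + α) ^ 2) := by
              linarith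
            exact lt_of_mul_lt_mul_left this (by positivity)
          rw [← harc]
          refine Real.arccos_le_arccos (le_of_lt ?_)
          by_contra hcon
          have := (hq _ hcos).1 (not_lt.1 hcon)
          nlinarith
      · push_cast
        rw [hx]
        ring
      · push_cast
        rw [hy]
        ring

lemma arctan_le_self {x : ℝ} (hx : 0 ≤ x) : Real.arctan x ≤ x := by
  have h1 := Real.arctan_nonneg.2 hx
  have h2 := Real.le_tan h1 (Real.arctan_lt_pi_div_two x)
  rwa [Real.tan_arctan] at h2

lemma abs_cos_sq_cordicAngle_sub_le {A B : ℕ} (hA : 0 < A) (t : ℕ) :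
    |Real.cos (cordicAngle A B t) ^ 2 - A / (A + B)| ≤ 4 * (1 / 2) ^ t := by
  obtain ⟨h0, hle, hge, -⟩ := cordic_spec (B := B) hA t
  have hA' : (0 : ℝ) < A := by exact_mod_cast hA
  have hB' : (0 : ℝ) ≤ B := by positivity
  have hq0 : (0 : ℝ) ≤ A / (A + B) := by positivity
  have hq1 : (A : ℝ) / (A + B) ≤ 1 := by
    rw [div_le_one (by positivity)]
    linarith
  set θ := cordicAngle A B t
  set θs := Real.arccos √(A / (A + B)) with hθs
  have hcs : Real.cos θs = √(A / (A + B)) :=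
    Real.cos_arccos (by linarith [Real.sqrt_nonneg ((A : ℝ) / (A + B))])
      (Real.sqrt_le_one.2 hq1)
  have hsq : (A : ℝ) / (A + B) = Real.cos θs ^ 2 := by rw [hcs, Real.sq_sqrt hq0]
  have h1 : |Real.cos θ - Real.cos θs| ≤ |θ - θs| := Real.abs_cos_sub_cos_le _ _
  have h2 : |θ - θs| ≤ 2 * (1 / 2) ^ t := by
    have := arctan_le_self (x := (1 / 2) ^ t) (by positivity)
    rw [abs_le]
    constructor <;> linarith [show (0 : ℝ) ≤ (1 / 2) ^ t by positivity]
  have h3 : |Real.cos θ + Real.cos θs| ≤ 2 := by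
    refine (abs_add_le _ _).trans ?_
    linarith [Real.abs_cos_le_one θ, Real.abs_cos_le_one θs]
  rw [hsq, sq_sub_sq, abs_mul]
  calc _ ≤ 2 * (2 * (1 / 2) ^ t) :=
        mul_le_mul h3 (h1.trans h2) (abs_nonneg _) (by norm_num)
    _ = _ := by ring

/-- (√a - √b)² ≤ |a - b|. The loss of half the precision is the origin of the `2 * m` among the
digits used below. -/
lemma abs_sqrt_sub_sqrt_le {a b ε : ℝ} (ha : 0 ≤ a) (hb : 0 ≤ b) (hε : 0 ≤ ε)
    (h : |a - b| ≤ ε ^ 2) : |√a - √b| ≤ ε := by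
  refine abs_le_of_sq_le_sq' ?_ hε |> abs_le.2
  have h1 := Real.sq_sqrt ha
  have h2 := Real.sq_sqrt hb
  have h3 := Real.sqrt_nonneg a
  have h4 := Real.sqrt_nonneg b
  rw [abs_le] at h
  rcases le_total (√a) (√b) with hle | hle <;> nlinarith

/-- The rotation angle computed from approximate weights splits the amplitude correctly. -/
lemma abs_sqrt_mul_cordic_sub_le {p₀ p₁ : ℝ} (h₀ : 0 ≤ p₀) (h₁ : 0 ≤ p₁) (h : p₀ + p₁ ≤ 1)
    {E₀ E₁ : ℕ} (m : ℕ) (hE₀ : |(E₀ : ℝ) / 2 ^ (2 * m + 5) - p₀| ≤ (1 / 2) ^ (2 * m + 5))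
    (hE₁ : |(E₁ : ℝ) / 2 ^ (2 * m + 5) - p₁| ≤ (1 / 2) ^ (2 * m + 5)) :
    |√(p₀ + p₁) * Real.cos (cordicAngle (E₀ + 1) E₁ (2 * m + 5)) - √p₀| ≤ (1 / 2) ^ m ∧
    |√(p₀ + p₁) * Real.sin (cordicAngle (E₀ + 1) E₁ (2 * m + 5)) - √p₁| ≤ (1 / 2) ^ m := by
  set M := 2 * m + 5 with hM
  set ε : ℝ := (1 / 2) ^ M with hε
  have hε0 : 0 < ε := by positivity
  have hε1 : ε ≤ 1 / 32 := by
    have : ε = (1 / 2) ^ (2 * m) * (1 / 32) := by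
      rw [hε, hM, pow_add]
      norm_num
    rw [this]
    have : ((1 : ℝ) / 2) ^ (2 * m) ≤ 1 := pow_le_one₀ (by norm_num) (by norm_num)
    linarith
  -- The 5 extra bits provide the factor 32 that absorbs the constants below.
  have hδ : 32 * ε = ((1 / 2) ^ m) ^ 2 := by
    rw [hε, hM, pow_add, ← pow_mul, mul_comm 2 m]
    ring
  have hinv : ∀ z : ℝ, z / 2 ^ M = z * ε := fun z => by
    rw [hε, one_div, inv_pow, div_eq_mul_inv]
  obtain ⟨hθ0, hθ1, -⟩ := cordic_spec (A := E₀ + 1) (B := E₁) (by omega) M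
  have hcos := abs_cos_sq_cordicAngle_sub_le (A := E₀ + 1) (B := E₁) (by omega) M
  set θ := cordicAngle (E₀ + 1) E₁ M
  have hθ2 : θ ≤ Real.pi / 2 := hθ1.trans (Real.arccos_le_pi_div_two.2 (Real.sqrt_nonneg _))
  have hc0 : 0 ≤ Real.cos θ := Real.cos_nonneg_of_neg_pi_div_two_le_of_le (by linarith) hθ2
  have hs0 : 0 ≤ Real.sin θ := Real.sin_nonneg_of_nonneg_of_le_pi hθ0 (by linarith [Real.pi_pos])
  rw [hinv] at hE₀ hE₁
  push_cast at hcos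
  set a : ℝ := (E₀ : ℝ) with ha
  set b : ℝ := (E₁ : ℝ) with hb
  have ha0 : 0 ≤ a := by positivity
  have hb0 : 0 ≤ b := by positivity
  rw [abs_le] at hE₀ hE₁
  have hab : (a + 1 + b) * ε ≤ 2 := by linarith
  -- The error is 8ε from the angle, 3ε from the total weight and 2ε from the weight of the lower
  -- half, including the ε by which `E₀ + 1` keeps the weight positive. No relative accuracy is
  -- needed: when p₀ + p₁ is tiny the angle may be far off, but it is multiplied by the small total
  -- amplitude.
  have hmain : |(p₀ + p₁) * Real.cos θ ^ 2 - p₀| ≤ 32 * ε := by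
    have h1 : |(a + 1 + b) * ε * Real.cos θ ^ 2 - (a + 1) * ε| ≤ 8 * ε := by
      have : (a + 1 + b) * ε * Real.cos θ ^ 2 - (a + 1) * ε =
          (a + 1 + b) * ε * (Real.cos θ ^ 2 - (a + 1) / (a + 1 + b)) := by
        field_simp
      rw [this, abs_mul, abs_of_nonneg (by positivity)]
      calc _ ≤ 2 * (4 * ε) := mul_le_mul hab hcos (abs_nonneg _) (by norm_num)
        _ = _ := by ring
    have hc1 : Real.cos θ ^ 2 ≤ 1 := Real.cos_sq_le_one θ
    have hc2 := sq_nonneg (Real.cos θ)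
    have h2 : |(p₀ + p₁ - (a + 1 + b) * ε) * Real.cos θ ^ 2| ≤ 3 * ε := by
      rw [abs_mul, abs_of_nonneg hc2]
      have : |p₀ + p₁ - (a + 1 + b) * ε| ≤ 3 * ε := by
        rw [abs_le]
        constructor <;> linarith
      calc _ ≤ 3 * ε * 1 := mul_le_mul this hc1 hc2 (by positivity)
        _ = _ := by ring
    rw [abs_le] at h1 h2 ⊢
    constructor <;> linarith
  have hP : 0 ≤ p₀ + p₁ := by linarith
  constructor
  · have : √(p₀ + p₁) * Real.cos θ = √((p₀ + p₁) * Real.cos θ ^ 2) := by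
      rw [Real.sqrt_mul hP, Real.sqrt_sq hc0]
    rw [this]
    exact abs_sqrt_sub_sqrt_le (by positivity) h₀ (by positivity) (hδ ▸ hmain)
  · have : √(p₀ + p₁) * Real.sin θ = √((p₀ + p₁) * Real.sin θ ^ 2) := by
      rw [Real.sqrt_mul hP, Real.sqrt_sq hs0]
    rw [this]
    refine abs_sqrt_sub_sqrt_le (by positivity) h₁ (by positivity) (hδ ▸ ?_)
    rw [Real.sin_sq, ← abs_neg]
    convert hmain using 2
    ring

/-! ### Rotations controlled by computed angles -/

section Rotation

variable {R X : Type} [Fintype R] [DecidableEq R]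

/-- The qubits `R` together with `a` ancillas in state `|0⟩`. -/
def anc (a : ℕ) (y : R → Bool) : R ⊕ Fin a → Bool := Sum.elim y fun _ => false

lemma anc_injective (a : ℕ) : Function.Injective (anc a : (R → Bool) → R ⊕ Fin a → Bool) := by
  intro x y h
  ext r
  exact congrFun h (Sum.inl r)

lemma gateAct_gateR_ket {Q : Type} [Fintype Q] [DecidableEq Q] (a : Q) (θ : ℝ) (y : Q → Bool)
    (hy : y a = false) : gateAct (.one a (gateR θ)) (ket y) =
      (Real.cos θ : ℂ) • ket y + (Real.sin θ : ℂ) • ket (Function.update y a true) := by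
  have : Function.update y a false = y := by rw [← hy, Function.update_eq_self]
  rw [gateAct_one_ket, Fintype.sum_bool, hy, this, add_comm]
  simp [gateR]

/-- Compute the digits, rotate `q` under their control, uncompute. Undoing the computation is exact
on both branches of the superposition because the program does not read `q`. The two computations
cost 6n gates each. -/
theorem Reach.exists_rotation (q : R) (β : X → R → Bool) (hβ : ∀ x, β x q = false)
    {S : Set (X → Bool)} (hS : ∀ f ∈ S, f = (fun _ => false) ∨ ∃ r, r ≠ q ∧ ∀ x, β x r = f x)
    {n : ℕ} {S' : Set (X → Bool)} (h : Reach S n S') (K : ℕ) (d : ℕ → X → Bool)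
    (hd : ∀ i < K, d i ∈ S') (α : ℕ → ℝ) :
    ∃ (a : ℕ) (C : QCircuit (R ⊕ Fin a)), C.length ≤ 12 * n + K ∧ a ≤ n + 1 ∧
      ∀ x, act C (ket (anc a (β x))) =
        (Real.cos (∑ i ∈ Finset.range K, ((d i x).toNat : ℝ) * α i) : ℂ) • ket (anc a (β x)) +
        (Real.sin (∑ i ∈ Finset.range K, ((d i x).toNat : ℝ) * α i) : ℂ) •
          ket (anc a (Function.update (β x) q true)) := by
  rcases isEmpty_or_nonempty X with hX | ⟨⟨x₀⟩⟩
  · exact ⟨0, [], by simp, by simp, fun x => hX.elim x⟩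
  -- The Boolean component is the value of `q`; projecting it away makes the ancilla contents the
  -- same for both values.
  obtain ⟨a, C, g, hC, ha, hact, hw⟩ := h.exists_circuit (Z := X × Bool)
    (fun z => Function.update (β z.1) q z.2) Prod.fst (by
      intro f hf
      rcases hS f hf with rfl | ⟨r, hr, hf⟩
      · exact Or.inl rfl
      · exact Or.inr ⟨r, fun z => by rw [Function.update_of_ne hr, hf]⟩)
  set Y : X → R ⊕ Fin a → Bool := fun x => Sum.elim (β x) (g x) with hY
  have hβ' : ∀ x, Function.update (β x) q false = β x := fun x => by
    rw [← hβ x, Function.update_eq_self]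
  have hrot : ∀ k ≤ K, ∃ D : QCircuit (R ⊕ Fin a), D.length = k ∧
      ∀ x, act D (ket (Y x)) = gateAct (.one (Sum.inl q)
        (gateR (∑ i ∈ Finset.range k, ((d i x).toNat : ℝ) * α i))) (ket (Y x)) := by
    intro k
    induction k with
    | zero => exact fun _ => ⟨[], rfl, fun x => by simp [gateR_zero]⟩
    | succ k ih =>
      intro hk
      obtain ⟨D, hD, hDact⟩ := ih (by omega)
      obtain ⟨w, hwire⟩ := hw _ (hd k (by omega))
      -- A digit is the same for both values of `q`, so its wire cannot be `q` itself.
      have hne : Sum.inl q ≠ w := by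
        rintro rfl
        have h0 := hwire (x₀, false)
        have h1 := hwire (x₀, true)
        simp only [Sum.elim_inl, Function.update_self] at h0 h1
        exact absurd (h0.trans h1.symm) (by decide)
      refine ⟨D ++ [ctrl w (Sum.inl q) hne (gateR (α k))], by simp [hD], fun x => ?_⟩
      have hYw : Y x w = d k x := by
        rw [← hwire (x, false)]
        simp [hY, hβ']
      rw [act_append, hDact, act_cons, act_nil, gateAct_ctrl_one, hYw, Finset.sum_range_succ,
        add_comm, ← gateR_mul]
      cases d k x <;> simp [gateR_zero]
  obtain ⟨D, hD, hDact⟩ := hrot K le_rfl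
  have hinv : ∀ x b, act (circInv C) (ket (Sum.elim (Function.update (β x) q b) (g x))) =
      ket (anc a (Function.update (β x) q b)) := by
    intro x b
    have := hact (x, b)
    simp only at this
    rw [← this, act_circInv_act]
    rfl
  refine ⟨a, C ++ D ++ circInv C, by simp only [List.length_append, length_circInv]; omega, ha,
    fun x => ?_⟩
  have h0 := hact (x, false)
  have hi0 := hinv x false
  simp only [hβ'] at h0 hi0
  have h1 : act C (ket (anc a (β x))) = ket (Y x) := h0
  rw [act_append, act_append, h1, hDact, gateAct_gateR_ket _ _ _ (by simp [hY, hβ]), map_add,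
    map_smul, map_smul, hY]
  simp only [Sum.update_elim_inl]
  rw [hi0, hinv x true]

end Rotation

/-! ### One level of the state preparation -/

/-- The binary digits of `j` in a register of `n` qubits. -/
def regBits (n j : ℕ) : Fin n → Bool := fun t => j.testBit t

lemma testBit_two_mul_mul_two_pow (i t : ℕ) :
    (2 * i * 2 ^ t).testBit t = false ∧ ((2 * i + 1) * 2 ^ t).testBit t = true ∧
    ∀ s, s ≠ t → ((2 * i + 1) * 2 ^ t).testBit s = (2 * i * 2 ^ t).testBit s := by
  refine ⟨?_, ?_, fun s hs => ?_⟩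
  · simp [Nat.testBit_mul_two_pow]
  · simp [Nat.testBit_mul_two_pow]
  · rw [Nat.testBit_mul_two_pow, Nat.testBit_mul_two_pow]
    rcases lt_or_ge s t with h | h
    · simp [h.not_ge]
    · obtain ⟨u, hu⟩ : ∃ u, s - t = u + 1 := ⟨s - t - 1, by omega⟩
      simp only [hu, h, decide_true, Bool.true_and, Nat.testBit_succ]
      congr 1
      omega

/-- The number of NAND gates that compute the angles of one level. -/
def levelCost (M s : ℕ) : ℕ := 2 * s + 42 * (M + 1) * opCost (2 * (M + 1) ^ 2 + (M + 2))

section Level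

variable {n N m M : ℕ} (C : BoolCircuit (M + 1)) (F : ℕ → ℝ)

/-- The weight of the basis states from `a` to `b`. -/
def mass (N : ℕ) (F : ℕ → ℝ) (a b : ℕ) : ℝ := F (min b N) - F (min a N)

/-- The circuit `C` approximates the weights with accuracy `2⁻ᴹ`. -/
def Approximates (N : ℕ) : Prop := ∀ i j : ℕ, i ≤ j → j ≤ N →
  |(C.eval (bits (Nat.size N) i ++ bits (Nat.size N) j) : ℝ) / 2 ^ M - (F j - F i)| ≤
    (1 / 2) ^ M

lemma BoolCircuit.eval_lt {o : ℕ} (C : BoolCircuit o) (x : List Bool) : C.eval x < 2 ^ o := by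
  rw [BoolCircuit.eval, sum_toNat_eq_ofBits]
  exact Nat.ofBits_lt_two_pow _

/-- The qubits above `t` determine the block number `i`, hence the three boundary points of the two
halves. Clamping these to `N` gives the states beyond `N` mass zero and keeps the Boolean circuit
within its domain. -/
theorem exists_level_circuit (hM : M = 2 * m + 5) (hN : N ≤ 2 ^ n) (hm : n ≤ m) (hC : Approximates C F N)
    (hmono : ∀ i j, i ≤ j → j ≤ N → F i ≤ F j) (hF0 : F 0 = 0) (hFN : F N = 1) {t : ℕ}
    (ht : t < n) :
    ∃ (a : ℕ) (D : QCircuit (Fin n ⊕ Fin a)),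
      D.length ≤ 12 * levelCost M C.gates.length + M ∧
      a ≤ 12 * levelCost M C.gates.length + M ∧
      ∀ i < 2 ^ (n - (t + 1)), ∃ θ : ℝ, act D (ket (anc a (regBits n (2 * i * 2 ^ t)))) =
        (Real.cos θ : ℂ) • ket (anc a (regBits n (2 * i * 2 ^ t))) +
        (Real.sin θ : ℂ) • ket (anc a (regBits n ((2 * i + 1) * 2 ^ t))) ∧
        |√(mass N F (2 * i * 2 ^ t) ((2 * i + 2) * 2 ^ t)) * Real.cos θ -
          √(mass N F (2 * i * 2 ^ t) ((2 * i + 1) * 2 ^ t))| ≤ (1 / 2) ^ m ∧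
        |√(mass N F (2 * i * 2 ^ t) ((2 * i + 2) * 2 ^ t)) * Real.sin θ -
          √(mass N F ((2 * i + 1) * 2 ^ t) ((2 * i + 2) * 2 ^ t))| ≤ (1 / 2) ^ m := by
  have h2t := Nat.two_pow_pos t
  set w := 2 * (M + 1) ^ 2 + (M + 2) with hw
  let X := {i : ℕ // i < 2 ^ (n - (t + 1))}
  -- Qubit `t` is excluded from the inputs, since it is the one to be rotated.
  let S₀ : Set (X → Bool) := {f | f = (fun _ => false) ∨
    ∃ r : Fin n, r ≠ ⟨t, ht⟩ ∧ ∀ x : X, regBits n (2 * x.1 * 2 ^ t) r = f x}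
  have hfalse : (fun _ => false) ∈ S₀ := Or.inl rfl
  -- One NAND of `false` with itself provides the constant `true`.
  have h₁ := Reach.step Reach.refl hfalse hfalse
  set S₁ := insert (fun x : X => !(false && false)) S₀
  have hS₁ : Consts S₁ := by
    intro b
    cases b
    · exact Or.inr hfalse
    · exact Or.inl rfl
  have hi : Has S₁ fun x : X => x.1 := by
    intro s
    right
    rcases lt_or_ge (s + t + 1) n with hs | hs
    · right
      refine ⟨⟨s + t + 1, hs⟩, by simp [Fin.ext_iff]; omega, fun x => ?_⟩
      have : 2 * x.1 * 2 ^ t = x.1 * 2 ^ (t + 1) := by ring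
      rw [regBits, this, Nat.testBit_mul_two_pow]
      simp [show t + 1 ≤ s + t + 1 by omega, show s + t + 1 - (t + 1) = s by omega]
    · left
      ext x
      exact Nat.testBit_lt_two_pow (x.2.trans_le (Nat.pow_le_pow_right (by norm_num) (by omega)))
  -- The width `w` grows with `M`, and `n ≤ m` makes the block boundaries fit into it.
  have hnw : 2 ^ n < 2 ^ w := Nat.pow_lt_pow_right (by norm_num) (by omega)
  have hNw : N < 2 ^ w := hN.trans_lt hnw
  have hxb : ∀ x : X, (2 * x.1 + 2) * 2 ^ t ≤ 2 ^ n := by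
    intro x
    have h1 : 2 ^ n = 2 ^ (n - (t + 1)) * (2 * 2 ^ t) := by
      rw [← pow_succ', ← pow_add]
      congr 1
      omega
    have h2 := x.2
    calc (2 * x.1 + 2) * 2 ^ t = (x.1 + 1) * (2 * 2 ^ t) := by ring
      _ ≤ _ := by rw [h1]; exact Nat.mul_le_mul_right _ h2
  have hlo' : CompN S₁ (opCost w) fun x : X => x.1 * 2 ^ (t + 1) := by
    have := (hi.comp.mul (w := w) hS₁ (hS₁.has (2 ^ (t + 1))).comp
      (fun _ => (Nat.pow_le_pow_right (by norm_num) (by omega : t + 1 ≤ n)).trans_lt hnw)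
      fun x => ?_).weaken (by omega : _ ≤ opCost w)
    · exact this
    · have h1 := hxb x
      have h2 : (2 * x.1 + 2) * 2 ^ t = x.1 * 2 ^ (t + 1) + 2 ^ (t + 1) := by ring
      omega
  have hlo : CompN S₁ (opCost w) fun x : X => 2 * x.1 * 2 ^ t := by
    convert hlo' using 2 with x
    ring
  have hmid : CompN S₁ (2 * opCost w) fun x : X => (2 * x.1 + 1) * 2 ^ t := by
    have := (hlo.add (w := w) hS₁ (hS₁.has (2 ^ t)).comp fun x => ?_).weaken
      (by omega : _ ≤ 2 * opCost w)
    · convert this using 2 with x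
      ring
    · have h1 := hxb x
      have h2 : (2 * x.1 + 2) * 2 ^ t = 2 * x.1 * 2 ^ t + 2 ^ t + 2 ^ t := by ring
      omega
  have hhi : CompN S₁ (2 * opCost w) fun x : X => (2 * x.1 + 2) * 2 ^ t := by
    have := (hlo.add (w := w) hS₁ (hS₁.has (2 * 2 ^ t)).comp fun x => ?_).weaken
      (by omega : _ ≤ 2 * opCost w)
    · convert this using 2 with x
      ring
    · have h1 := hxb x
      have h2 : (2 * x.1 + 2) * 2 ^ t = 2 * x.1 * 2 ^ t + 2 * 2 ^ t := by ring
      omega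
  have hmin : ∀ {k : ℕ} {f : X → ℕ}, CompN S₁ k f → (∀ x, f x ≤ 2 ^ n) →
      CompN S₁ (2 * k + 2 * opCost w) fun x => min (f x) N := by
    intro k f hf hfn
    have hfw := fun x => (hfn x).trans_lt hnw
    -- The minimum of f and N is f - (f - N) with truncated subtractions.
    have := (hf.sub (w := w) hS₁ (hf.sub (w := w) hS₁ (hS₁.has N).comp hfw fun _ => hNw) hfw
      fun x => (Nat.sub_le _ _).trans_lt (hfw x)).weaken (by omega : _ ≤ 2 * k + 2 * opCost w)
    convert this using 2 with x
    omega
  have hordlo : ∀ x : X, 2 * x.1 * 2 ^ t ≤ (2 * x.1 + 1) * 2 ^ t := fun x =>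
    Nat.mul_le_mul_right _ (by omega)
  have hordhi : ∀ x : X, (2 * x.1 + 1) * 2 ^ t ≤ (2 * x.1 + 2) * 2 ^ t := fun x =>
    Nat.mul_le_mul_right _ (by omega)
  have hmlo := hmin hlo fun x => (hordlo x).trans ((hordhi x).trans (hxb x))
  have hmmid := hmin hmid fun x => (hordhi x).trans (hxb x)
  have hmhi := hmin hhi hxb
  set E₀ : X → ℕ := fun x => C.eval (bits (Nat.size N) (min (2 * x.1 * 2 ^ t) N) ++
    bits (Nat.size N) (min ((2 * x.1 + 1) * 2 ^ t) N)) with hE₀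
  set E₁ : X → ℕ := fun x => C.eval (bits (Nat.size N) (min ((2 * x.1 + 1) * 2 ^ t) N) ++
    bits (Nat.size N) (min ((2 * x.1 + 2) * 2 ^ t) N)) with hE₁
  have hE₀c : CompN S₁ _ E₀ := CompN.eval C (Nat.size N) hS₁ hmlo hmmid
  have hE₁c : CompN S₁ _ E₁ := CompN.eval C (Nat.size N) hS₁ hmmid hmhi
  have hpow : 2 ^ (M + 2) = 2 * 2 ^ (M + 1) := by ring
  have hMw : 2 ^ (M + 2) < 2 ^ w := by
    refine Nat.pow_lt_pow_right (by norm_num) ?_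
    have : 0 < (M + 1) ^ 2 := by positivity
    omega
  have hE₀lt : ∀ x, E₀ x + 1 < 2 ^ (M + 2) := fun x => by
    have := BoolCircuit.eval_lt C (bits (Nat.size N) (min (2 * x.1 * 2 ^ t) N) ++
      bits (Nat.size N) (min ((2 * x.1 + 1) * 2 ^ t) N))
    have h2 : 1 < 2 ^ (M + 1) := Nat.one_lt_two_pow (by omega)
    simp only [hE₀]
    omega
  have hE₁lt : ∀ x, E₁ x < 2 ^ (M + 2) := fun x => by
    have := BoolCircuit.eval_lt C (bits (Nat.size N) (min ((2 * x.1 + 1) * 2 ^ t) N) ++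
      bits (Nat.size N) (min ((2 * x.1 + 2) * 2 ^ t) N))
    simp only [hE₁]
    omega
  obtain ⟨S₂, h₂, hA, hB⟩ := (hE₀c.add (w := w) hS₁ (hS₁.has 1).comp
    fun x => (hE₀lt x).trans hMw).pair hE₁c
  obtain ⟨S₃, h₃, -, -, hd⟩ := exists_reach_cordic (hS₁.mono h₂.subset) hA hB (by omega) hE₀lt
    hE₁lt M le_rfl
  obtain ⟨a, D, hD, ha, hact⟩ := ((h₁.trans h₂).trans h₃).exists_rotation (⟨t, ht⟩ : Fin n)
    (fun x : X => regBits n (2 * x.1 * 2 ^ t))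
    (fun x => (testBit_two_mul_mul_two_pow x.1 t).1) (fun f hf => hf) M
    (fun s x => (cordicDigit (E₀ x + 1) (E₁ x) s).testBit 0) (fun s hs => hd s hs 0)
    (fun s => Real.arctan ((1 / 2) ^ s))
  have hop : 0 < opCost w := Nat.mul_pos (by norm_num) (pow_pos (Nat.succ_pos _) 2)
  have hlev : levelCost M C.gates.length =
      2 * C.gates.length + (42 * (M * opCost w) + 42 * opCost w) := by
    rw [levelCost, ← hw]
    ring
  have h18 : 18 * opCost w * M = 18 * (M * opCost w) := by ring
  rw [h18] at hD ha
  rw [hlev]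
  refine ⟨a, D, by omega, by omega, fun i hi => ?_⟩
  · have hang : ∀ x : X, ∑ s ∈ Finset.range M,
        (((cordicDigit (E₀ x + 1) (E₁ x) s).testBit 0).toNat : ℝ) * Real.arctan ((1 / 2) ^ s) =
        cordicAngle (E₀ x + 1) (E₁ x) M := by
      intro x
      refine Finset.sum_congr rfl fun s _ => ?_
      congr 2
      have := cordicDigit_le_one (E₀ x + 1) (E₁ x) s
      generalize cordicDigit (E₀ x + 1) (E₁ x) s = b at this
      interval_cases b <;> simp
    have hx := hact ⟨i, hi⟩
    rw [hang] at hx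
    have hupd : Function.update (regBits n (2 * i * 2 ^ t)) ⟨t, ht⟩ true =
        regBits n ((2 * i + 1) * 2 ^ t) := by
      obtain ⟨h1, h2, h3⟩ := testBit_two_mul_mul_two_pow i t
      ext s
      by_cases hs : s = ⟨t, ht⟩
      · subst hs
        simp [regBits, h2]
      · rw [Function.update_of_ne hs]
        exact (h3 s fun h => hs (Fin.ext h)).symm
    simp only [hupd] at hx
    refine ⟨_, hx, ?_⟩
    have hol := hordlo ⟨i, hi⟩
    have hoh := hordhi ⟨i, hi⟩
    have hm0 : 0 ≤ mass N F (2 * i * 2 ^ t) ((2 * i + 1) * 2 ^ t) :=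
      sub_nonneg.2 (hmono _ _ (min_le_min_right _ hol) (min_le_right _ _))
    have hm1 : 0 ≤ mass N F ((2 * i + 1) * 2 ^ t) ((2 * i + 2) * 2 ^ t) :=
      sub_nonneg.2 (hmono _ _ (min_le_min_right _ hoh) (min_le_right _ _))
    have hadd : mass N F (2 * i * 2 ^ t) ((2 * i + 2) * 2 ^ t) =
        mass N F (2 * i * 2 ^ t) ((2 * i + 1) * 2 ^ t) +
        mass N F ((2 * i + 1) * 2 ^ t) ((2 * i + 2) * 2 ^ t) := by
      unfold mass
      ring
    have hle1 : mass N F (2 * i * 2 ^ t) ((2 * i + 2) * 2 ^ t) ≤ 1 := by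
      have h1 := hmono (min ((2 * i + 2) * 2 ^ t) N) N (min_le_right _ _) le_rfl
      have h2 := hmono 0 (min (2 * i * 2 ^ t) N) (Nat.zero_le _) (min_le_right _ _)
      unfold mass
      linarith
    rw [hadd] at hle1 ⊢
    subst hM
    exact abs_sqrt_mul_cordic_sub_le hm0 hm1 hle1 m
      (hC _ _ (min_le_min_right _ hol) (min_le_right _ _))
      (hC _ _ (min_le_min_right _ hoh) (min_le_right _ _))

end Level

/-! ### Approximate transformations of states -/

section Transforms

variable {R : Type} [Fintype R] [DecidableEq R]

lemma embed_sub {α Q : Type} [Fintype α] [Fintype Q] [DecidableEq Q] (e : α → Q → Bool)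
    (ψ χ : EuclideanSpace ℂ α) : embed e (ψ - χ) = embed e ψ - embed e χ :=
  map_sub (embedLin e) ψ χ

lemma embed_smul {α Q : Type} [Fintype α] [Fintype Q] [DecidableEq Q] (e : α → Q → Bool)
    (c : ℂ) (ψ : EuclideanSpace ℂ α) : embed e (c • ψ) = c • embed e ψ :=
  map_smul (embedLin e) c ψ

lemma embed_eq_sum {α Q : Type} [Fintype α] [Fintype Q] [DecidableEq Q] (e : α → Q → Bool)
    (ψ : EuclideanSpace ℂ α) : embed e ψ = ∑ i, ψ i • ket (e i) := by
  ext x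
  simp only [embed, WithLp.ofLp_sum, WithLp.ofLp_smul, Finset.sum_apply, Pi.smul_apply,
    smul_eq_mul, PiLp.single_apply, mul_ite, mul_one, mul_zero]
  exact Finset.sum_congr rfl fun i _ => by simp [eq_comm]

lemma extend_inl (a : ℕ) (y : R → Bool) :
    Function.extend (Function.Embedding.inl : R ↪ R ⊕ Fin a) y (fun _ => false) = anc a y := by
  ext x
  rcases x with r | i
  · exact (Function.Embedding.inl : R ↪ R ⊕ Fin a).injective.extend_apply _ _ r
  · rw [Function.extend_apply']
    · rfl
    · rintro ⟨r, hr⟩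
      cases hr

lemma act_circMap_inl (a : ℕ) (C : QCircuit R) (ψ : EuclideanSpace ℂ (R → Bool)) :
    act (circMap (Function.Embedding.inl : R ↪ R ⊕ Fin a) C) (embed (anc a) ψ) =
      embed (anc a) (act C ψ) := by
  have := act_circMap (Function.Embedding.inl : R ↪ R ⊕ Fin a) (fun _ => false) C ψ
  simpa only [extend_inl] using this

lemma extend_castLE {a b : ℕ} (hab : a ≤ b) (y : R → Bool) :
    Function.extend ((Function.Embedding.refl R).sumMap (Fin.castLEEmb hab)) (anc a y)
      (fun _ => false) = anc b y := by
  set f := (Function.Embedding.refl R).sumMap (Fin.castLEEmb hab)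
  ext x
  by_cases hx : ∃ q, f q = x
  · obtain ⟨q, rfl⟩ := hx
    rw [f.injective.extend_apply]
    rcases q with r | i <;> rfl
  · rw [Function.extend_apply' _ _ _ hx]
    rcases x with r | i
    · exact absurd ⟨Sum.inl r, rfl⟩ hx
    · rfl

/-- The additional ancillas stay idle in |0⟩ and the embedding is isometric, so the error is
unchanged. This gives circuits a common ancilla space for composition. -/
lemma exists_widen {a b : ℕ} (hab : a ≤ b) (C : QCircuit (R ⊕ Fin a)) :
    ∃ C' : QCircuit (R ⊕ Fin b), C'.length = C.length ∧ ∀ ψ χ : EuclideanSpace ℂ (R → Bool),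
      ‖act C' (embed (anc b) ψ) - embed (anc b) χ‖ =
        ‖act C (embed (anc a) ψ) - embed (anc a) χ‖ := by
  set f := (Function.Embedding.refl R).sumMap (Fin.castLEEmb hab) with hf
  refine ⟨circMap f C, by simp, fun ψ χ => ?_⟩
  have h : ∀ ω : EuclideanSpace ℂ (R → Bool), embed (anc b) ω =
      embed (fun x => Function.extend f x fun _ => false) (embed (anc a) ω) := by
    intro ω
    rw [embed_embed]
    simp only [hf, extend_castLE]
  rw [h, h, act_circMap, ← embed_sub, norm_embed (extend_injective f _)]

/-- Some circuit with at most `L` gates and at most `L` ancillas takes `ψ` to `χ` up to the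
error `ε`. -/
def Transforms (L : ℕ) (ψ χ : EuclideanSpace ℂ (R → Bool)) (ε : ℝ) : Prop :=
  ∃ (a : ℕ) (C : QCircuit (R ⊕ Fin a)), C.length ≤ L ∧ a ≤ L ∧
    ‖act C (embed (anc a) ψ) - embed (anc a) χ‖ ≤ ε

lemma Transforms.trans {L₁ L₂ : ℕ} {ψ χ ω : EuclideanSpace ℂ (R → Bool)} {ε₁ ε₂ : ℝ}
    (h₁ : Transforms L₁ ψ χ ε₁) (h₂ : Transforms L₂ χ ω ε₂) :
    Transforms (L₁ + L₂) ψ ω (ε₁ + ε₂) := by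
  obtain ⟨a₁, C₁, hC₁, ha₁, h₁⟩ := h₁
  obtain ⟨a₂, C₂, hC₂, ha₂, h₂⟩ := h₂
  obtain ⟨D₁, hD₁, hd₁⟩ := exists_widen (le_max_left a₁ a₂) C₁
  obtain ⟨D₂, hD₂, hd₂⟩ := exists_widen (le_max_right a₁ a₂) C₂
  refine ⟨max a₁ a₂, D₁ ++ D₂, by simp; omega, by omega, ?_⟩
  rw [← hd₁] at h₁
  rw [← hd₂] at h₂
  set e : (R → Bool) → _ := anc (R := R) (max a₁ a₂)
  calc ‖act (D₁ ++ D₂) (embed e ψ) - embed e ω‖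
      = ‖act D₂ (act D₁ (embed e ψ) - embed e χ) + (act D₂ (embed e χ) - embed e ω)‖ := by
        rw [act_append, map_sub]
        congr 1
        abel
    _ ≤ _ := (norm_add_le _ _).trans (by rw [norm_act]; gcongr)

lemma Transforms.refl (ψ : EuclideanSpace ℂ (R → Bool)) : Transforms 0 ψ ψ 0 :=
  ⟨0, [], by simp, by simp, by simp⟩

lemma Transforms.mono {L L' : ℕ} {ψ χ : EuclideanSpace ℂ (R → Bool)} {ε ε' : ℝ}
    (h : Transforms L ψ χ ε) (hL : L ≤ L') (hε : ε ≤ ε') : Transforms L' ψ χ ε' := by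
  obtain ⟨a, C, hC, ha, h⟩ := h
  exact ⟨a, C, hC.trans hL, ha.trans hL, h.trans hε⟩

lemma exists_clear (s : Finset R) (y : R → Bool) : ∃ D : QCircuit R,
    D.length ≤ s.card ∧ act D (ket y) = ket (fun r => if r ∈ s then false else y r) := by
  induction s using Finset.induction_on with
  | empty => exact ⟨[], by simp⟩
  | insert r s hr ih =>
    obtain ⟨D, hD, hact⟩ := ih
    rw [Finset.card_insert_of_notMem hr]
    cases hy : y r
    · refine ⟨D, by omega, hact.trans ?_⟩
      congr 1
      ext q
      by_cases hq : q = r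
      · subst hq
        simp [hy]
      · simp [hq]
    · refine ⟨D ++ [.one r gateX], by simpa using hD, ?_⟩
      rw [act_append, hact, act_cons, act_nil, gateAct_X_ket]
      congr 1
      ext q
      by_cases hq : q = r
      · subst hq
        simp [hr, hy]
      · simp [hq]

/-- The basis state is known, so flipping its set bits resets it; preparation from any |b⟩ reduces
to preparation from |0⟩. -/
lemma transforms_ket_clear (y : R → Bool) :
    Transforms (Fintype.card R) (ket y) (ket fun _ => false) 0 := by
  obtain ⟨D, hD, hact⟩ := exists_clear Finset.univ y
  refine ⟨0, circMap Function.Embedding.inl D, by simpa using hD, by simp, ?_⟩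
  rw [act_circMap_inl, hact]
  simp

end Transforms

/-! ### State preparation level by level -/

lemma sum_range_two_mul {V : Type*} [AddCommMonoid V] (f : ℕ → V) (k : ℕ) :
    ∑ i ∈ Finset.range (2 * k), f i = ∑ i ∈ Finset.range k, (f (2 * i) + f (2 * i + 1)) := by
  induction k with
  | zero => simp
  | succ k ih =>
    rw [mul_add, mul_one, Finset.sum_range_succ, Finset.sum_range_succ, ih,
      Finset.sum_range_succ, add_assoc]

section Levels

variable {n N m M : ℕ} (C : BoolCircuit (M + 1)) (F : ℕ → ℝ)

/-- The state of the first `n - t` leading qubits of the register. -/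
def levelState (n N : ℕ) (F : ℕ → ℝ) (t : ℕ) : EuclideanSpace ℂ (Fin n → Bool) :=
  ∑ i ∈ Finset.range (2 ^ (n - t)),
    (√(mass N F (i * 2 ^ t) ((i + 1) * 2 ^ t)) : ℂ) • ket (regBits n (i * 2 ^ t))

/-- The triangle inequality over 2^(n-t-1) blocks, each with two amplitudes that are off by at most
2⁻ᵐ. -/
theorem transforms_level (hM : M = 2 * m + 5) (hN : N ≤ 2 ^ n) (hm : n ≤ m)
    (hC : Approximates C F N) (hmono : ∀ i j, i ≤ j → j ≤ N → F i ≤ F j) (hF0 : F 0 = 0)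
    (hFN : F N = 1) {t : ℕ} (ht : t < n) :
    Transforms (12 * levelCost M C.gates.length + M) (levelState n N F (t + 1))
      (levelState n N F t) (2 ^ n * (1 / 2) ^ m) := by
  obtain ⟨a, D, hD, ha, hact⟩ := exists_level_circuit C F hM hN hm hC hmono hF0 hFN ht
  choose! θ hθ hcos hsin using hact
  refine ⟨a, D, hD, ha, ?_⟩
  have hpow : 2 ^ (n - t) = 2 * 2 ^ (n - (t + 1)) := by
    rw [← pow_succ']
    congr 1
    omega
  have h1 : levelState n N F (t + 1) = ∑ i ∈ Finset.range (2 ^ (n - (t + 1))),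
      (√(mass N F (2 * i * 2 ^ t) ((2 * i + 2) * 2 ^ t)) : ℂ) •
        ket (regBits n (2 * i * 2 ^ t)) := by
    refine Finset.sum_congr rfl fun i _ => ?_
    have e1 : i * 2 ^ (t + 1) = 2 * i * 2 ^ t := by ring
    have e2 : (i + 1) * 2 ^ (t + 1) = (2 * i + 2) * 2 ^ t := by ring
    rw [e1, e2]
  have h2 : levelState n N F t = ∑ i ∈ Finset.range (2 ^ (n - (t + 1))),
      ((√(mass N F (2 * i * 2 ^ t) ((2 * i + 1) * 2 ^ t)) : ℂ) •
        ket (regBits n (2 * i * 2 ^ t)) +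
      (√(mass N F ((2 * i + 1) * 2 ^ t) ((2 * i + 2) * 2 ^ t)) : ℂ) •
        ket (regBits n ((2 * i + 1) * 2 ^ t))) := by
    rw [levelState, hpow, sum_range_two_mul]
  have he : ∀ y, embed (anc a) (ket y) = ket (anc a y : Fin n ⊕ Fin a → Bool) := fun y =>
    embed_single _ _
  rw [h1, h2, ← embedLin_apply, ← embedLin_apply, map_sum, map_sum, map_sum,
    ← Finset.sum_sub_distrib]
  have hterm : ∀ i ∈ Finset.range (2 ^ (n - (t + 1))),
      ‖act D (embedLin (anc a) ((√(mass N F (2 * i * 2 ^ t) ((2 * i + 2) * 2 ^ t)) : ℂ) •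
        ket (regBits n (2 * i * 2 ^ t)))) -
      embedLin (anc a) ((√(mass N F (2 * i * 2 ^ t) ((2 * i + 1) * 2 ^ t)) : ℂ) •
        ket (regBits n (2 * i * 2 ^ t)) +
      (√(mass N F ((2 * i + 1) * 2 ^ t) ((2 * i + 2) * 2 ^ t)) : ℂ) •
        ket (regBits n ((2 * i + 1) * 2 ^ t)))‖ ≤ 2 * (1 / 2) ^ m := by
    intro i hi
    rw [Finset.mem_range] at hi
    simp only [map_add, map_smul, embedLin_apply, he, hθ i hi]
    set P := mass N F (2 * i * 2 ^ t) ((2 * i + 2) * 2 ^ t)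
    set P₀ := mass N F (2 * i * 2 ^ t) ((2 * i + 1) * 2 ^ t)
    set P₁ := mass N F ((2 * i + 1) * 2 ^ t) ((2 * i + 2) * 2 ^ t)
    set k₀ := ket (anc a (regBits n (2 * i * 2 ^ t)))
    set k₁ := ket (anc a (regBits n ((2 * i + 1) * 2 ^ t)))
    have e : (√P : ℂ) • ((Real.cos (θ i) : ℂ) • k₀ + (Real.sin (θ i) : ℂ) • k₁) -
        ((√P₀ : ℂ) • k₀ + (√P₁ : ℂ) • k₁) =
        ((√P * Real.cos (θ i) - √P₀ : ℝ) : ℂ) • k₀ +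
        ((√P * Real.sin (θ i) - √P₁ : ℝ) : ℂ) • k₁ := by
      push_cast
      module
    rw [e]
    refine (norm_add_le _ _).trans ?_
    have hc := hcos i hi
    have hs := hsin i hi
    have hk₀ : ‖k₀‖ = 1 := by simp [k₀]
    have hk₁ : ‖k₁‖ = 1 := by simp [k₁]
    rw [norm_smul, norm_smul, Complex.norm_real, Complex.norm_real, hk₀, hk₁, Real.norm_eq_abs,
      Real.norm_eq_abs]
    linarith
  refine (norm_sum_le_of_le _ hterm).trans ?_
  rw [Finset.sum_const, Finset.card_range, nsmul_eq_mul]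
  push_cast
  have h3 : (2 : ℝ) ^ (n - (t + 1)) * 2 ≤ 2 ^ n := by
    rw [← pow_succ]
    exact pow_le_pow_right₀ (by norm_num) (by omega)
  calc (2 : ℝ) ^ (n - (t + 1)) * (2 * (1 / 2) ^ m)
      = 2 ^ (n - (t + 1)) * 2 * (1 / 2) ^ m := by ring
    _ ≤ _ := by gcongr

/-- At level `n` there is a single block of mass 1, which is |0⟩; the n passages down to level 0 add
their errors. -/
theorem transforms_levelState (hM : M = 2 * m + 5) (hN : N ≤ 2 ^ n) (hm : n ≤ m)
    (hC : Approximates C F N) (hmono : ∀ i j, i ≤ j → j ≤ N → F i ≤ F j) (hF0 : F 0 = 0)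
    (hFN : F N = 1) :
    Transforms (n * (12 * levelCost M C.gates.length + M)) (ket fun _ => false)
      (levelState n N F 0) (n * (2 ^ n * (1 / 2) ^ m)) := by
  have key : ∀ k ≤ n, Transforms (k * (12 * levelCost M C.gates.length + M))
      (levelState n N F n) (levelState n N F (n - k)) (k * (2 ^ n * (1 / 2) ^ m)) := by
    intro k
    induction k with
    | zero =>
      intro _
      simpa using Transforms.refl _
    | succ k ih =>
      intro hk
      have h1 := ih (by omega)
      have h2 := transforms_level C F hM hN hm hC hmono hF0 hFN (t := n - (k + 1)) (by omega)
      rw [show n - (k + 1) + 1 = n - k by omega] at h2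
      refine (h1.trans h2).mono (le_of_eq (by ring)) (le_of_eq ?_)
      push_cast
      ring
  have h0 : levelState n N F n = ket fun _ => false := by
    have hz : regBits n 0 = fun _ => false := by
      ext t
      simp [regBits]
    simp [levelState, mass, hN, hF0, hFN, hz]
  have := key n le_rfl
  rwa [h0, Nat.sub_self] at this

/-- At level 0 the blocks are single points; those from `N` on have mass zero by the clamping. -/
lemma levelState_zero (hN : N ≤ 2 ^ n) (φ : EuclideanSpace ℂ (Fin N))
    (hφ : ∀ j : Fin N, φ j = √(F (j + 1) - F j)) :
    levelState n N F 0 = embed (fun j : Fin N => regBits n j) φ := by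
  rw [embed_eq_sum, levelState]
  simp only [pow_zero, mul_one, Nat.sub_zero]
  rw [← Finset.sum_subset (Finset.range_subset_range.2 hN), Finset.sum_range]
  · refine Finset.sum_congr rfl fun j _ => ?_
    rw [hφ, mass, min_eq_left j.2, min_eq_left j.2.le]
  · intro j _ hj
    have : N ≤ j := by simpa using hj
    rw [mass, min_eq_right this, min_eq_right (by omega)]
    simp

end Levels

/-! ### Reflections -/

section Reflection

variable {R : Type} [Fintype R] [DecidableEq R]

/-- The sign change of `|0⟩`. -/
def gateNegZ : Matrix.unitaryGroup Bool ℂ :=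
  ⟨Matrix.of fun a b => if a = b then (if a then 1 else -1) else 0, by
    rw [Matrix.mem_unitaryGroup_iff]
    ext a b
    cases a <;> cases b <;> simp [Matrix.mul_apply, Matrix.star_apply]⟩

lemma gateAct_negZ_ket (a : R) (y : R → Bool) :
    gateAct (.one a gateNegZ) (ket y) = (if y a then (1 : ℂ) else -1) • ket y := by
  rw [gateAct_one_ket, Finset.sum_eq_single (y a)]
  · simp [gateNegZ]
  · intro b _ hb
    simp [gateNegZ, hb]
  · simp

lemma compB_forall_eq_false {S : Set ((R → Bool) → Bool)} (hS : Consts S)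
    (hS' : ∀ r, (fun y : R → Bool => y r) ∈ S) (s : Finset R) :
    CompB S (3 * s.card) fun y => decide (∀ r ∈ s, y r = false) := by
  induction s using Finset.induction_on with
  | empty => simpa using CompB.of_mem (hS true)
  | insert r s hr ih =>
    obtain ⟨S', h, hf⟩ := (CompB.of_mem (hS' r)).not.and ih
    refine ⟨S', h.weaken (by rw [Finset.card_insert_of_notMem hr]; omega), ?_⟩
    convert hf using 2 with y
    cases hy : y r <;> simp [hy]

/-- The reflection about the state `|0⟩` of all qubits. -/
theorem exists_reflection_zero (R : Type) [Fintype R] [DecidableEq R] :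
    ∃ (a : ℕ) (C : QCircuit (R ⊕ Fin a)), C.length ≤ 36 * Fintype.card R + 13 ∧
      ∀ ψ : EuclideanSpace ℂ (R → Bool), act C (embed (anc a) ψ) =
        embed (anc a) ((2 * inner ℂ (ket fun _ => false) ψ) • (ket fun _ => false) - ψ) := by
  let S₀ : Set ((R → Bool) → Bool) := {f | f = (fun _ => false) ∨ ∃ r, ∀ y, y r = f y}
  have hfalse : (fun _ => false) ∈ S₀ := Or.inl rfl
  have h₁ := Reach.step Reach.refl hfalse hfalse
  set S₁ := insert (fun _ : R → Bool => !(false && false)) S₀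
  have hS₁ : Consts S₁ := by
    intro b
    cases b
    · exact Or.inr hfalse
    · exact Or.inl rfl
  obtain ⟨S₂, h₂, hf⟩ := compB_forall_eq_false hS₁ (fun r => Or.inr (Or.inr ⟨r, fun _ => rfl⟩))
    (Finset.univ : Finset R)
  obtain ⟨a, C, g, hC, -, hact, hw⟩ := (h₁.trans h₂).exists_circuit (Z := R → Bool) id id
    (fun f hf => hf)
  obtain ⟨q, hq⟩ := hw _ hf
  -- Compute whether all qubits are 0, change the sign when they are not, uncompute: this is 2|0⟩⟨0|
  -- - I.
  refine ⟨a, C ++ [.one q gateNegZ] ++ circInv C, ?_, fun ψ => ?_⟩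
  · rw [Finset.card_univ] at hC
    simp only [List.length_append, length_circInv, List.length_singleton]
    omega
  · suffices h : act (C ++ [.one q gateNegZ] ++ circInv C) ∘ₗ embedLin (anc a) =
        embedLin (anc a) ∘ₗ (((2 : ℂ) • LinearMap.toSpanSingleton ℂ _ (ket fun _ => false) ∘ₗ
          (innerSL ℂ (ket fun _ => false : EuclideanSpace ℂ (R → Bool))).toLinearMap) -
          LinearMap.id) by
      have := LinearMap.congr_fun h ψ
      simpa [embedLin_apply, mul_smul] using this
    apply lin_ext
    intro y
    have hy := hact y
    have hqy := hq y
    simp only [id] at hy hqy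
    have hk : embed (anc a) (ket y) = ket (anc a y) := embed_single _ _
    have hanc : (anc a y : R ⊕ Fin a → Bool) = Sum.elim y fun _ => false := rfl
    rw [LinearMap.comp_apply, embedLin_apply, hk, hanc, act_append, act_append, hy, act_cons,
      act_nil, gateAct_negZ_ket, hqy, map_smul, ← hy, act_circInv_act, ← hanc, ← hk,
      ← embed_smul, LinearMap.comp_apply, embedLin_apply]
    congr 1
    by_cases h : ∀ r, y r = false
    · obtain rfl : y = fun _ => false := funext h
      simp
      module
    · have hne : (fun _ => false) ≠ y := fun h' => h fun r => by rw [← h']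
      have hin : inner ℂ (ket fun _ => false) (ket y) = 0 := by
        rw [EuclideanSpace.inner_single_left]
        simp [hne]
      simp [h, hin]

end Reflection

/-! ### Block-diagonal operators -/

section Blocks

variable {N : ℕ}

/-- The operator `∑_i |i⟩⟨i| ⊗ M_i`, by its entries. -/
def blk (B : Fin N → Matrix (Fin N) (Fin N) ℂ) : Matrix (Fin N × Fin N) (Fin N × Fin N) ℂ :=
  Matrix.of fun x y => if x.1 = y.1 then B x.1 x.2 y.2 else 0

lemma blk_mul (B B' : Fin N → Matrix (Fin N) (Fin N) ℂ) :
    blk B * blk B' = blk fun i => B i * B' i := by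
  ext x y
  simp only [blk, Matrix.mul_apply, Matrix.of_apply, Fintype.sum_prod_type, ite_mul, zero_mul,
    mul_ite, mul_zero]
  rw [Finset.sum_eq_single x.1]
  · simp only [if_true]
    split_ifs <;> simp
  · intro k _ hk
    simp [hk.symm]
  · simp

lemma blk_one : blk (fun _ : Fin N => 1) = 1 := by
  ext ⟨i, j⟩ ⟨i', j'⟩
  by_cases hi : i = i' <;> by_cases hj : j = j' <;> simp [blk, Matrix.one_apply, hi, hj]

lemma blk_conjTranspose (B : Fin N → Matrix (Fin N) (Fin N) ℂ) :
    (blk B)ᴴ = blk fun i => (B i)ᴴ := by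
  ext x y
  simp only [blk, Matrix.conjTranspose_apply, Matrix.of_apply, apply_ite star, star_zero]
  by_cases h : x.1 = y.1
  · simp [h]
  · simp [h, Ne.symm h]

lemma controlledOp_eq_blk (T : Fin N → Matrix (Fin N) (Fin N) ℂ) : controlledOp T = blk T := by
  ext x y
  rw [controlledOp, Matrix.sum_apply, Finset.sum_eq_single x.1]
  · simp only [blk, Matrix.kronecker, Matrix.kroneckerMap_apply, Matrix.single_apply,
      Matrix.of_apply, true_and]
    split_ifs <;> simp
  · intro i _ hi
    simp [Matrix.kronecker, hi]
  · simp

lemma projector_eq_blk (P : Matrix (Fin N) (Fin N) ℝ) :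
    projector P = blk fun i => Matrix.vecMulVec (colState P i) (star (colState P i)) := by
  ext x y
  rw [projector, Matrix.sum_apply, Finset.sum_eq_single x.1]
  · simp only [blk, Matrix.vecMulVec_apply, projState, Matrix.of_apply, Pi.star_apply, star_mul']
    by_cases h : x.1 = y.1
    · simp [h]
    · simp [h, Ne.symm h]
  · intro i _ hi
    simp [Matrix.vecMulVec_apply, projState, hi.symm]
  · simp

/-- The reflection about the vector `φ`. -/
def reflMatrix (φ : Fin N → ℂ) : Matrix (Fin N) (Fin N) ℂ :=
  (2 : ℂ) • Matrix.vecMulVec φ (star φ) - 1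

/-- Conjugation by a unitary moves the axis of a reflection: T† takes χ back to φ. -/
lemma conjTranspose_mul_reflMatrix_mul (φ χ : Fin N → ℂ) (T : Matrix (Fin N) (Fin N) ℂ)
    (hT : T ∈ Matrix.unitaryGroup (Fin N) ℂ) (h : T *ᵥ φ = χ) :
    Tᴴ * reflMatrix χ * T = reflMatrix φ := by
  have hT' : Tᴴ * T = 1 := Matrix.mem_unitaryGroup_iff'.1 hT
  have h1 : Tᴴ *ᵥ χ = φ := by rw [← h, Matrix.mulVec_mulVec, hT', Matrix.one_mulVec]
  have h2 : star χ ᵥ* T = star φ := by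
    rw [← h1, Matrix.star_mulVec, Matrix.conjTranspose_conjTranspose]
  rw [reflMatrix, Matrix.mul_sub, Matrix.sub_mul, Matrix.mul_smul, Matrix.smul_mul,
    Matrix.mul_vecMulVec, Matrix.vecMulVec_mul, h1, h2, Matrix.mul_one, hT', reflMatrix]

lemma reflMatrix_mul_self (φ : Fin N → ℂ) (hφ : star φ ⬝ᵥ φ = 1) :
    reflMatrix φ * reflMatrix φ = 1 := by
  have h : Matrix.vecMulVec φ (star φ) * Matrix.vecMulVec φ (star φ) =
      Matrix.vecMulVec φ (star φ) := by
    rw [Matrix.vecMulVec_mul_vecMulVec, hφ]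
    simp
  simp only [reflMatrix, sub_mul, mul_sub, one_mul, mul_one, Matrix.smul_mul, Matrix.mul_smul, h]
  module

lemma conjTranspose_reflMatrix (φ : Fin N → ℂ) : (reflMatrix φ)ᴴ = reflMatrix φ := by
  simp [reflMatrix, Matrix.conjTranspose_vecMulVec]

lemma blk_mem_unitaryGroup {B : Fin N → Matrix (Fin N) (Fin N) ℂ}
    (hB : ∀ i, B i ∈ Matrix.unitaryGroup (Fin N) ℂ) :
    blk B ∈ Matrix.unitaryGroup (Fin N × Fin N) ℂ := by
  rw [Matrix.mem_unitaryGroup_iff, Matrix.star_eq_conjTranspose, blk_conjTranspose, blk_mul,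
    ← blk_one]
  congr 1
  ext1 i
  exact Matrix.mem_unitaryGroup_iff.1 (hB i)

lemma controlledOp_inv {T : Fin N → Matrix (Fin N) (Fin N) ℂ}
    (hT : ∀ i, T i ∈ Matrix.unitaryGroup (Fin N) ℂ) :
    (controlledOp T)⁻¹ = blk fun i => (T i)ᴴ := by
  apply Matrix.inv_eq_left_inv
  rw [controlledOp_eq_blk, blk_mul, ← blk_one]
  congr 1
  ext1 i
  exact Matrix.mem_unitaryGroup_iff'.1 (hT i)

/-- All factors but the swap are block-diagonal, so the conjugation identity for each T_i can be
applied block by block. The middle factor no longer depends on the block. -/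
lemma walkOp_eq (P : Matrix (Fin N) (Fin N) ℝ) {T : Fin N → Matrix (Fin N) (Fin N) ℂ} {r : Fin N}
    (hT : ∀ i, T i ∈ Matrix.unitaryGroup (Fin N) ℂ)
    (h : ∀ i, T i *ᵥ colState P i = colState P r) :
    walkOp P = swapOp N * ((controlledOp T)⁻¹ *
      ((blk fun _ => reflMatrix (colState P r)) * controlledOp T)) := by
  have h1 : (2 : ℂ) • projector P - 1 = blk fun i => reflMatrix (colState P i) := by
    rw [projector_eq_blk, ← blk_one]
    ext x y
    simp only [blk, Matrix.sub_apply, Matrix.smul_apply, Matrix.of_apply, reflMatrix]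
    split_ifs <;> simp
  rw [walkOp, h1, controlledOp_inv hT, controlledOp_eq_blk, blk_mul, blk_mul]
  congr 2
  ext1 i
  rw [← Matrix.mul_assoc, conjTranspose_mul_reflMatrix_mul _ _ _ (hT i) (h i)]

end Blocks

/-! ### Implementations with ancillas -/

section Impl

variable {R α : Type} [Fintype R] [DecidableEq R] [Fintype α] [DecidableEq α]

lemma norm_toEuclideanLin {A : Matrix α α ℂ} (hA : A ∈ Matrix.unitaryGroup α ℂ)
    (ψ : EuclideanSpace ℂ α) : ‖Matrix.toEuclideanLin A ψ‖ = ‖ψ‖ := by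
  have h : inner ℂ (Matrix.toEuclideanLin A ψ) (Matrix.toEuclideanLin A ψ) = inner ℂ ψ ψ := by
    rw [← LinearMap.adjoint_inner_right, ← Matrix.toEuclideanLin_conjTranspose_eq_adjoint,
      ← toEuclideanLin_mul, ← Matrix.star_eq_conjTranspose, Matrix.mem_unitaryGroup_iff'.1 hA]
    simp
  rw [@norm_eq_sqrt_re_inner ℂ, @norm_eq_sqrt_re_inner ℂ, h]

/-- Some circuit with at most `L` gates and some ancillas implements `A` up to the error `ε`. -/
def Impl (e : α → R → Bool) (L : ℕ) (A : Matrix α α ℂ) (ε : ℝ) : Prop :=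
  ∃ (a : ℕ) (C : QCircuit (R ⊕ Fin a)), C.length ≤ L ∧ Implements (fun i => anc a (e i)) C A ε

lemma implements_anc_iff {e : α → R → Bool} {a : ℕ} {C : QCircuit (R ⊕ Fin a)}
    {A : Matrix α α ℂ} {ε : ℝ} : Implements (fun i => anc a (e i)) C A ε ↔
      ∀ ψ, ‖act C (embed (anc a) (embed e ψ)) -
        embed (anc a) (embed e (Matrix.toEuclideanLin A ψ))‖ ≤ ε * ‖ψ‖ := by
  simp only [embed_embed]
  rfl

/-- The second circuit errs relative to ‖Aψ‖, which equals ‖ψ‖ as A is unitary; circuits preserve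
the first error. -/
lemma Impl.comp {e : α → R → Bool} {L₁ L₂ : ℕ} {A B : Matrix α α ℂ} {ε₁ ε₂ : ℝ}
    (h₁ : Impl e L₁ A ε₁) (h₂ : Impl e L₂ B ε₂) (hA : A ∈ Matrix.unitaryGroup α ℂ) :
    Impl e (L₁ + L₂) (B * A) (ε₁ + ε₂) := by
  obtain ⟨a₁, C₁, hC₁, h₁⟩ := h₁
  obtain ⟨a₂, C₂, hC₂, h₂⟩ := h₂
  rw [implements_anc_iff] at h₁ h₂
  obtain ⟨D₁, hD₁, hd₁⟩ := exists_widen (le_max_left a₁ a₂) C₁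
  obtain ⟨D₂, hD₂, hd₂⟩ := exists_widen (le_max_right a₁ a₂) C₂
  refine ⟨max a₁ a₂, D₁ ++ D₂, by simp; omega, ?_⟩
  rw [implements_anc_iff]
  intro ψ
  have h₁ := h₁ ψ
  have h₂ := h₂ (Matrix.toEuclideanLin A ψ)
  rw [← hd₁] at h₁
  rw [← hd₂, norm_toEuclideanLin hA] at h₂
  rw [toEuclideanLin_mul]
  set E : (R → Bool) → _ := anc (R := R) (max a₁ a₂)
  set x := embed E (embed e ψ)
  set y := embed E (embed e (Matrix.toEuclideanLin A ψ))
  set z := embed E (embed e (Matrix.toEuclideanLin B (Matrix.toEuclideanLin A ψ)))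
  calc ‖act (D₁ ++ D₂) x - z‖ = ‖act D₂ (act D₁ x - y) + (act D₂ y - z)‖ := by
        rw [act_append, map_sub]
        congr 1
        abel
    _ ≤ ε₁ * ‖ψ‖ + ε₂ * ‖ψ‖ := (norm_add_le _ _).trans (by rw [norm_act]; gcongr)
    _ = _ := by ring

lemma Impl.mono {e : α → R → Bool} {L L' : ℕ} {A : Matrix α α ℂ} {ε ε' : ℝ}
    (h : Impl e L A ε) (hL : L ≤ L') (hε : ε ≤ ε') : Impl e L' A ε' := by
  obtain ⟨a, C, hC, h⟩ := h
  exact ⟨a, C, hC.trans hL, fun ψ => (h ψ).trans (by gcongr)⟩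

end Impl

/-! ### The swap of two registers -/

/-- The circuit that exchanges one qubit of two registers. -/
def swapQubits {R : Type} (r : R) : QCircuit (R ⊕ R) :=
  [cnot (Sum.inl r) (Sum.inr r) Sum.inr_ne_inl, cnot (Sum.inr r) (Sum.inl r) Sum.inl_ne_inr,
    cnot (Sum.inl r) (Sum.inr r) Sum.inr_ne_inl]

lemma act_swapQubits {R : Type} [Fintype R] [DecidableEq R] (r : R) (u v : R → Bool) :
    act (swapQubits r) (ket (Sum.elim u v)) =
      ket (Sum.elim (Function.update u r (v r)) (Function.update v r (u r))) := by
  simp only [swapQubits, act_cons, act_nil, gateAct_cnot_ket, Sum.update_elim_inl,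
    Sum.update_elim_inr, Sum.elim_inl, Sum.elim_inr, Function.update_self, Function.update_idem]
  cases u r <;> cases v r <;> rfl

lemma exists_swap_circuit {R : Type} [Fintype R] [DecidableEq R] (s : Finset R) :
    ∃ C : QCircuit (R ⊕ R), C.length ≤ 3 * s.card ∧ ∀ u v : R → Bool,
      act C (ket (Sum.elim u v)) = ket (Sum.elim (fun r => if r ∈ s then v r else u r)
        fun r => if r ∈ s then u r else v r) := by
  induction s using Finset.induction_on with
  | empty => exact ⟨[], by simp, fun u v => by simp⟩
  | insert r s hr ih =>
    obtain ⟨C, hC, hact⟩ := ih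
    refine ⟨C ++ swapQubits r, ?_, fun u v => ?_⟩
    · rw [Finset.card_insert_of_notMem hr]
      simp only [List.length_append, List.length_cons, List.length_nil, swapQubits]
      omega
    · rw [act_append, hact, act_swapQubits]
      congr 1
      ext q
      rcases q with q | q <;> by_cases hq : q = r
      · subst hq
        simp [hr]
      · simp [hq]
      · subst hq
        simp [hr]
      · simp [hq]

/-- The basis states of two registers in binary. -/
def regPair (N : ℕ) (x : Fin N × Fin N) : Fin (regSize N) ⊕ Fin (regSize N) → Bool :=
  Sum.elim (regBits (regSize N) x.1) (regBits (regSize N) x.2)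

lemma swapOp_single {N : ℕ} (i j : Fin N) :
    Matrix.toEuclideanLin (swapOp N) (EuclideanSpace.single (i, j) 1) =
      EuclideanSpace.single (j, i) 1 := by
  ext ⟨k, l⟩
  rw [toEuclideanLin_single, swapOp, Matrix.sum_apply]
  simp only [Matrix.sum_apply, Matrix.single_apply, PiLp.single_apply, Prod.mk.injEq]
  rw [Finset.sum_eq_single k, Finset.sum_eq_single l]
  · by_cases h1 : k = j <;> by_cases h2 : l = i <;> simp [h1, h2]
  · intro b _ hb
    simp [hb]
  · simp
  · intro b _ hb
    simp [hb]
  · simp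

lemma impl_swapOp (N : ℕ) : Impl (regPair N) (3 * regSize N) (swapOp N) 0 := by
  obtain ⟨C, hC, hact⟩ := exists_swap_circuit (Finset.univ : Finset (Fin (regSize N)))
  refine ⟨0, circMap Function.Embedding.inl C, by simpa using hC, ?_⟩
  rw [implements_anc_iff]
  intro ψ
  suffices h : act C ∘ₗ embedLin (regPair N) =
      embedLin (regPair N) ∘ₗ Matrix.toEuclideanLin (swapOp N) by
    have := LinearMap.congr_fun h ψ
    simp only [LinearMap.comp_apply, embedLin_apply] at this
    rw [act_circMap_inl, this]
    simp
  apply lin_ext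
  rintro ⟨i, j⟩
  rw [LinearMap.comp_apply, LinearMap.comp_apply, embedLin_apply, embedLin_apply, swapOp_single,
    embed_single, embed_single, regPair, hact]
  simp [regPair]

/-! ### The reflection of the second register -/

section Reflection

variable {N : ℕ}

/-- The states of the second register that belong to the basis state `i` of the first one. -/
def slice (ψ : EuclideanSpace ℂ (Fin N × Fin N)) (i : Fin N) : EuclideanSpace ℂ (Fin N) :=
  WithLp.toLp 2 fun j => ψ (i, j)

lemma norm_slice_le (ψ : EuclideanSpace ℂ (Fin N × Fin N)) (i : Fin N) : ‖slice ψ i‖ ≤ ‖ψ‖ := by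
  rw [EuclideanSpace.norm_eq, EuclideanSpace.norm_eq, Fintype.sum_prod_type]
  refine Real.sqrt_le_sqrt ?_
  exact Finset.single_le_sum (f := fun i => ∑ j, ‖ψ (i, j)‖ ^ 2)
    (fun i _ => Finset.sum_nonneg fun j _ => by positivity) (Finset.mem_univ i)

lemma embed_regPair (ψ : EuclideanSpace ℂ (Fin N × Fin N)) :
    embed (regPair N) ψ = ∑ i : Fin N, embed (Sum.elim (regBits (regSize N) i))
      (embed (fun j : Fin N => regBits (regSize N) j) (slice ψ i)) := by
  simp only [embed_embed]
  rw [embed_eq_sum, Fintype.sum_prod_type]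
  refine Finset.sum_congr rfl fun i _ => ?_
  rw [embed_eq_sum]
  rfl

lemma slice_blk_reflMatrix (φ : Fin N → ℂ) (ψ : EuclideanSpace ℂ (Fin N × Fin N)) (i : Fin N) :
    slice (Matrix.toEuclideanLin (blk fun _ => reflMatrix φ) ψ) i =
      (2 * inner ℂ (WithLp.toLp 2 φ) (slice ψ i)) • WithLp.toLp 2 φ - slice ψ i := by
  ext j
  simp only [slice, Matrix.toLpLin_apply, Matrix.mulVec, dotProduct, Fintype.sum_prod_type, blk,
    Matrix.of_apply, ite_mul, zero_mul]
  rw [Finset.sum_eq_single i]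
  · simp only [if_true, reflMatrix, Matrix.sub_apply, Matrix.smul_apply, Matrix.vecMulVec_apply,
      sub_mul, Finset.sum_sub_distrib, PiLp.inner_apply, WithLp.ofLp_sub, WithLp.ofLp_smul,
      Pi.sub_apply, Pi.smul_apply, smul_eq_mul, Pi.star_apply, RCLike.inner_apply,
      Finset.mul_sum, Finset.sum_mul, Matrix.one_apply, ite_mul, one_mul, zero_mul,
      Finset.sum_ite_eq, Finset.mem_univ, RCLike.star_def]
    congr 1
    exact Finset.sum_congr rfl fun k _ => by ring
  · intro k _ hk
    simp [hk.symm]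
  · simp

/-- The difference is 2⟨v - w, x⟩ v + 2⟨w, x⟩ (v - w), and each summand has norm at most 2ε‖x‖. -/
lemma norm_reflection_sub_le {V : Type*} [NormedAddCommGroup V] [InnerProductSpace ℂ V]
    {v w : V} (hv : ‖v‖ = 1) (hw : ‖w‖ = 1) {ε : ℝ} (h : ‖v - w‖ ≤ ε) (x : V) :
    ‖((2 * inner ℂ v x) • v - x) - ((2 * inner ℂ w x) • w - x)‖ ≤ 4 * ε * ‖x‖ := by
  have e : ((2 * inner ℂ v x) • v - x) - ((2 * inner ℂ w x) • w - x) =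
      (2 * inner ℂ (v - w) x) • v + (2 * inner ℂ w x) • (v - w) := by
    rw [inner_sub_left]
    module
  rw [e]
  refine (norm_add_le _ _).trans ?_
  rw [norm_smul, norm_smul, norm_mul, norm_mul, hv, Complex.norm_ofNat]
  have h1 : ‖inner ℂ (v - w) x‖ ≤ ε * ‖x‖ := (norm_inner_le_norm _ _).trans (by gcongr)
  have h2 : ‖inner ℂ w x‖ ≤ ‖x‖ := by simpa [hw] using norm_inner_le_norm (𝕜 := ℂ) w x
  have h3 : ‖inner ℂ w x‖ * ‖v - w‖ ≤ ‖x‖ * ε := mul_le_mul h2 h (norm_nonneg _) (norm_nonneg _)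
  linarith

lemma regBits_injective (N : ℕ) :
    Function.Injective fun j : Fin N => regBits (regSize N) j := by
  intro i j h
  have hN : N ≤ 2 ^ regSize N := Nat.le_pow_clog (by norm_num) N
  apply Fin.ext
  apply Nat.eq_of_testBit_eq
  intro t
  rcases lt_or_ge t (regSize N) with ht | ht
  · exact congrFun h ⟨t, ht⟩
  · have hp : 2 ^ regSize N ≤ 2 ^ t := Nat.pow_le_pow_right (by norm_num) ht
    rw [Nat.testBit_lt_two_pow (by omega), Nat.testBit_lt_two_pow (by omega)]

/-- The second register and two groups of ancillas among all qubits. -/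
def secondEmb (R : Type) (a a' : ℕ) : (R ⊕ Fin a) ⊕ Fin a' ↪ (R ⊕ R) ⊕ Fin (a + a') :=
  ((Equiv.sumAssoc R (Fin a) (Fin a')).trans
    (Equiv.sumCongr (Equiv.refl R) finSumFinEquiv)).toEmbedding.trans
    (Function.Embedding.inr.sumMap (Function.Embedding.refl (Fin (a + a'))))

lemma extend_secondEmb {R : Type} {a a' : ℕ} (u y : R → Bool) :
    Function.extend (secondEmb R a a') (anc a' (anc a y))
      (anc (a + a') (Sum.elim u fun _ => false)) = anc (a + a') (Sum.elim u y) := by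
  ext x
  by_cases hx : ∃ q, secondEmb R a a' q = x
  · obtain ⟨q, rfl⟩ := hx
    rw [(secondEmb R a a').injective.extend_apply]
    rcases q with (q | q) | q <;> rfl
  · rw [Function.extend_apply' _ _ _ hx]
    rcases x with (r | r) | i
    · rfl
    · exact absurd ⟨Sum.inl (Sum.inl r), rfl⟩ hx
    · rfl

/-- Conjugating the reflection about |0⟩ by K gives exactly the reflection about v = K|0⟩, which is
compared with the one about w = φ ⊗ |0⟩. The inner reflection acts on the ancillas of K as well;
this is why `Transforms` bounds their number, and 36 + 2 copies of `L` appear. Summing the error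
over the N basis states of the first register gives the factor N. -/
theorem impl_reflection {L : ℕ} {φ : Fin N → ℂ} {ε : ℝ}
    (hφ : ‖(WithLp.toLp 2 φ : EuclideanSpace ℂ (Fin N))‖ = 1)
    (h : Transforms L (ket fun _ => false)
      (embed (fun j : Fin N => regBits (regSize N) j) (WithLp.toLp 2 φ)) ε) :
    Impl (regPair N) (38 * L + 36 * regSize N + 13) (blk fun _ => reflMatrix φ)
      (N * (4 * ε)) := by
  obtain ⟨a, K, hK, ha, h⟩ := h
  obtain ⟨a', C, hC, hact⟩ := exists_reflection_zero (Fin (regSize N) ⊕ Fin a)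
  set e₁ : Fin N → Fin (regSize N) → Bool := fun j => regBits (regSize N) j
  set φ' : EuclideanSpace ℂ (Fin N) := WithLp.toLp 2 φ
  have hanc : embed (anc a) (ket fun _ => false) =
      (ket fun _ => false : EuclideanSpace ℂ (Fin (regSize N) ⊕ Fin a → Bool)) := by
    rw [embed_single]
    congr 1
    ext x
    rcases x with x | x <;> rfl
  rw [hanc] at h
  set v := act K (ket fun _ => false) with hv
  set w := embed (anc a) (embed e₁ φ') with hw
  have hinj := regBits_injective N
  have hv1 : ‖v‖ = 1 := by simp [hv]
  have hw1 : ‖w‖ = 1 := by rw [hw, norm_embed (anc_injective a), norm_embed hinj, hφ]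
  set D₀ := circMap Function.Embedding.inl (circInv K) ++ C ++ circMap Function.Embedding.inl K
    with hD₀
  have hD₀act : ∀ x, act D₀ (embed (anc a') x) = embed (anc a') ((2 * inner ℂ v x) • v - x) := by
    intro x
    rw [hD₀, act_append, act_append, act_circMap_inl, hact, act_circMap_inl, map_sub, map_smul,
      act_act_circInv, ← inner_act_left]
  refine ⟨a + a', circMap (secondEmb _ a a') D₀, ?_, ?_⟩
  · simp only [Fintype.card_sum, Fintype.card_fin] at hC
    simp only [hD₀, length_circMap, List.length_append, length_circInv]
    omega
  rw [implements_anc_iff]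
  intro ψ
  rw [embed_regPair, embed_regPair, ← embedLin_apply, ← embedLin_apply, map_sum, map_sum, map_sum,
    ← Finset.sum_sub_distrib]
  simp only [embedLin_apply]
  have hterm : ∀ i ∈ (Finset.univ : Finset (Fin N)),
      ‖act (circMap (secondEmb _ a a') D₀) (embed (anc (a + a'))
        (embed (Sum.elim (regBits (regSize N) i)) (embed e₁ (slice ψ i)))) -
        embed (anc (a + a')) (embed (Sum.elim (regBits (regSize N) i)) (embed e₁
          (slice (Matrix.toEuclideanLin (blk fun _ => reflMatrix φ) ψ) i)))‖ ≤
        4 * ε * ‖ψ‖ := by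
    intro i _
    have hemb : ∀ χ, embed (anc (a + a')) (embed (Sum.elim (regBits (regSize N) i)) χ) =
        embed (fun x => Function.extend (secondEmb _ a a') x
          (anc (a + a') (Sum.elim (regBits (regSize N) i) fun _ => false)))
          (embed (anc a') (embed (anc a) χ)) := by
      intro χ
      simp only [embed_embed, extend_secondEmb]
    rw [hemb, hemb, act_circMap, ← embed_sub, norm_embed (extend_injective _ _), hD₀act,
      ← embed_sub, norm_embed (anc_injective _), slice_blk_reflMatrix, embed_sub, embed_sub,
      embed_smul, embed_smul]
    -- As w is the isometric image of φ, its reflection restricts to the desired one on embedded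
    -- states.
    have hin : inner ℂ φ' (slice ψ i) = inner ℂ w (embed (anc a) (embed e₁ (slice ψ i))) := by
      rw [hw, inner_embed (anc_injective _), inner_embed hinj]
    rw [hin]
    refine (norm_reflection_sub_le hv1 hw1 h _).trans ?_
    rw [norm_embed (anc_injective _), norm_embed hinj]
    have hε : 0 ≤ ε := (norm_nonneg _).trans h
    exact mul_le_mul_of_nonneg_left (norm_slice_le ψ i) (by positivity)
  refine (norm_sum_le_of_le _ hterm).trans (le_of_eq ?_)
  rw [Finset.sum_const, Finset.card_univ, Fintype.card_fin, nsmul_eq_mul]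
  ring

end Reflection

/-! ### Polynomial bounds -/

/-- The function `f` is bounded by a polynomial. -/
def PolyBound (f : ℕ → ℕ) : Prop := ∃ c d : ℕ, ∀ s, f s ≤ c * (s + 1) ^ d

lemma PolyBound.const (k : ℕ) : PolyBound fun _ => k := ⟨k, 0, by simp⟩

lemma PolyBound.id : PolyBound fun s => s := ⟨1, 1, by simp⟩

lemma PolyBound.add {f g : ℕ → ℕ} (hf : PolyBound f) (hg : PolyBound g) :
    PolyBound fun s => f s + g s := by
  obtain ⟨c, d, hf⟩ := hf
  obtain ⟨c', d', hg⟩ := hg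
  refine ⟨c + c', d + d', fun s => ?_⟩
  calc f s + g s ≤ c * (s + 1) ^ d + c' * (s + 1) ^ d' := add_le_add (hf s) (hg s)
    _ ≤ c * (s + 1) ^ (d + d') + c' * (s + 1) ^ (d + d') := by gcongr <;> omega
    _ = _ := by ring

lemma PolyBound.mul {f g : ℕ → ℕ} (hf : PolyBound f) (hg : PolyBound g) :
    PolyBound fun s => f s * g s := by
  obtain ⟨c, d, hf⟩ := hf
  obtain ⟨c', d', hg⟩ := hg
  refine ⟨c * c', d + d', fun s => ?_⟩
  calc f s * g s ≤ c * (s + 1) ^ d * (c' * (s + 1) ^ d') := Nat.mul_le_mul (hf s) (hg s)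
    _ = _ := by ring

lemma PolyBound.pow {f : ℕ → ℕ} (hf : PolyBound f) (k : ℕ) : PolyBound fun s => f s ^ k := by
  obtain ⟨c, d, hf⟩ := hf
  refine ⟨c ^ k, d * k, fun s => ?_⟩
  calc f s ^ k ≤ (c * (s + 1) ^ d) ^ k := Nat.pow_le_pow_left (hf s) k
    _ = _ := by ring

lemma PolyBound.opCost {f : ℕ → ℕ} (hf : PolyBound f) : PolyBound fun s => opCost (f s) :=
  (PolyBound.const 50).mul ((hf.add (.const 1)).pow 2)

lemma PolyBound.levelCost {f g : ℕ → ℕ} (hf : PolyBound f) (hg : PolyBound g) :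
    PolyBound fun s => levelCost (f s) (g s) :=
  ((PolyBound.const 2).mul hg).add (((PolyBound.const 42).mul (hf.add (.const 1))).mul
    (((PolyBound.const 2).mul ((hf.add (.const 1)).pow 2)).add (hf.add (.const 2))).opCost)

lemma levelCost_mono {M M' s s' : ℕ} (hM : M ≤ M') (hs : s ≤ s') :
    levelCost M s ≤ levelCost M' s' := by
  unfold levelCost opCost
  gcongr

/-! ### Preparation of the reference state -/

section Prepare

variable {N : ℕ} {p : ℝ → ℝ} {z₀ Δz : ℝ}

/-- The integral of the density up to a grid point. -/
def gridCdf (p : ℝ → ℝ) (z₀ Δz : ℝ) (j : ℕ) : ℝ := ∫ z in z₀..(z₀ + j * Δz), p z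

lemma gridCdf_sub (hΔz : 0 < Δz) (hp : IsDensityOn p z₀ (z₀ + N * Δz)) {i j : ℕ} (hi : i ≤ N)
    (hj : j ≤ N) : gridCdf p z₀ Δz j - gridCdf p z₀ Δz i =
      ∫ z in (z₀ + i * Δz)..(z₀ + j * Δz), p z := by
  have hint : ∀ k : ℕ, k ≤ N →
      IntervalIntegrable p MeasureTheory.volume z₀ (z₀ + k * Δz) := by
    intro k hk
    have hk' : (k : ℝ) * Δz ≤ N * Δz := by gcongr
    have hk0 : (0 : ℝ) ≤ k * Δz := by positivity
    refine hp.2.1.mono_set ?_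
    rw [Set.uIcc_of_le (by linarith), Set.uIcc_of_le (by linarith)]
    exact Set.Icc_subset_Icc_right (by linarith)
  exact intervalIntegral.integral_interval_sub_left (hint j hj) (hint i hi)

lemma gridCdf_mono (hΔz : 0 < Δz) (hp : IsDensityOn p z₀ (z₀ + N * Δz)) {i j : ℕ} (hij : i ≤ j)
    (hj : j ≤ N) : gridCdf p z₀ Δz i ≤ gridCdf p z₀ Δz j := by
  rw [← sub_nonneg, gridCdf_sub hΔz hp (hij.trans hj) hj]
  have h1 : (i : ℝ) * Δz ≤ j * Δz := by gcongr
  have h2 : (j : ℝ) * Δz ≤ N * Δz := by gcongr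
  have h3 : (0 : ℝ) ≤ i * Δz := by positivity
  refine intervalIntegral.integral_nonneg (by linarith) fun z hz => hp.1 z ⟨?_, ?_⟩
  · linarith [hz.1]
  · linarith [hz.2]

theorem transforms_colState {ι : Type*} {N : ι → ℕ} {P : ∀ k, Matrix (Fin (N k)) (Fin (N k)) ℝ}
    {r : ∀ k, Fin (N k)} {p : ι → ℝ → ℝ} {z₀ Δz : ι → ℝ} (hΔz : ∀ k, 0 < Δz k)
    (hp : ∀ k, IsDensityOn (p k) (z₀ k) (z₀ k + N k * Δz k))
    (hPp : ∀ k (j : Fin (N k)), P k j (r k) =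
      ∫ z in (z₀ k + (j : ℕ) * Δz k)..(z₀ k + ((j : ℕ) + 1) * Δz k), p k z)
    (hp_eff : EfficientlyIntegrable N p z₀ Δz) :
    ∃ c d : ℕ, ∀ k m, Transforms (c * (regSize (N k) + m + 1) ^ d) (ket fun _ => false)
      (embed (fun j : Fin (N k) => regBits (regSize (N k)) j)
        (WithLp.toLp 2 (colState (P k) (r k)))) ((1 / 2) ^ m) := by
  obtain ⟨c, d, hp_eff⟩ := hp_eff
  have hM : PolyBound fun s => 4 * s + 5 := ((PolyBound.const 4).mul .id).add (.const 5)
  have hg : PolyBound fun s => c * (5 * s + 6) ^ d :=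
    (PolyBound.const c).mul ((((PolyBound.const 5).mul .id).add (.const 6)).pow d)
  obtain ⟨c', d', hbound⟩ := PolyBound.id.mul
    (((PolyBound.const 12).mul (hM.levelCost hg)).add hM)
  refine ⟨c', d', fun k m => ?_⟩
  -- The 2n extra bits pay for the loss n · 2^n ≤ 2^(2n) over all levels; the outer 2 · (…) + 5 is
  -- the precision needed for the angles.
  have hCk := hp_eff k (2 * (m + 2 * regSize (N k)) + 5)
  set n := regSize (N k) with hn
  obtain ⟨C, hlen, hC⟩ := hCk
  have hN : N k ≤ 2 ^ n := Nat.le_pow_clog (by norm_num) _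
  have happ : Approximates C (gridCdf (p k) (z₀ k) (Δz k)) (N k) := by
    intro i j hij hj
    rw [gridCdf_sub (hΔz k) (hp k) (hij.trans hj) hj]
    exact hC i j hij hj
  have key := transforms_levelState (m := m + 2 * n) C _ rfl hN (by omega) happ
    (fun i j hij hj => gridCdf_mono (hΔz k) (hp k) hij hj) (by simp [gridCdf]) (hp k).2.2
  rw [levelState_zero _ hN (WithLp.toLp 2 (colState (P k) (r k)))] at key
  · refine key.mono ?_ ?_
    · refine le_trans ?_ (hbound (n + m))
      have h1 : C.gates.length ≤ c * (5 * (n + m) + 6) ^ d := 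
        hlen.trans (Nat.mul_le_mul_left _ (Nat.pow_le_pow_left (by omega) _))
      have h2 : 2 * (m + 2 * n) + 5 ≤ 4 * (n + m) + 5 := by omega
      have := levelCost_mono h2 h1
      exact Nat.mul_le_mul (by omega) (add_le_add (Nat.mul_le_mul_left _ this) h2)
    · have h1 : (n : ℝ) ≤ 2 ^ n := by exact_mod_cast Nat.lt_two_pow_self.le
      have h2 : ((1 : ℝ) / 2) ^ (m + 2 * n) = (1 / 2) ^ m * ((1 / 2) ^ n * (1 / 2) ^ n) := by
        rw [pow_add, two_mul, pow_add]
      have h3 : (2 : ℝ) ^ n * (1 / 2) ^ n = 1 := by rw [← mul_pow]; norm_num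
      calc (n : ℝ) * (2 ^ n * (1 / 2) ^ (m + 2 * n))
          ≤ 2 ^ n * (2 ^ n * (1 / 2) ^ (m + 2 * n)) := by gcongr
        _ = (1 / 2) ^ m * ((2 ^ n * (1 / 2) ^ n) * (2 ^ n * (1 / 2) ^ n)) := by rw [h2]; ring
        _ = _ := by rw [h3]; ring
  · intro j
    rw [gridCdf_sub (hΔz k) (hp k) j.2.le j.2]
    push_cast
    rw [← hPp]
    rfl

end Prepare

lemma star_dotProduct_colState {N : ℕ} {P : Matrix (Fin N) (Fin N) ℝ}
    (hP : P ∈ Matrix.colStochastic ℝ (Fin N)) (i : Fin N) :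
    star (colState P i) ⬝ᵥ colState P i = 1 := by
  have h0 : ∀ j, 0 ≤ P j i := fun j => (Matrix.mem_colStochastic_iff_sum.1 hP).1 j i
  have h1 : ∑ j, P j i = 1 := (Matrix.mem_colStochastic_iff_sum.1 hP).2 i
  simp only [dotProduct, colState, Pi.star_apply, RCLike.star_def, Complex.conj_ofReal]
  rw [← Complex.ofReal_one, ← h1, Complex.ofReal_sum]
  refine Finset.sum_congr rfl fun j _ => ?_
  rw [← Complex.ofReal_mul, Real.mul_self_sqrt (h0 j)]

lemma norm_toLp_eq_one {N : ℕ} {φ : Fin N → ℂ} (hφ : star φ ⬝ᵥ φ = 1) :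
    ‖(WithLp.toLp 2 φ : EuclideanSpace ℂ (Fin N))‖ = 1 := by
  rw [@norm_eq_sqrt_re_inner ℂ, EuclideanSpace.inner_toLp_toLp, dotProduct_comm, hφ]
  simp

theorem efficientlyPreparable_of_transforms {ι : Type*} {N : ι → ℕ} {φ : ∀ k, Fin (N k) → ℂ}
    {c d : ℕ} (h : ∀ k m, Transforms (c * (regSize (N k) + m + 1) ^ d) (ket fun _ => false)
      (embed (fun j : Fin (N k) => regBits (regSize (N k)) j) (WithLp.toLp 2 (φ k)))
      ((1 / 2) ^ m)) (b : ∀ k, Fin (N k)) : EfficientlyPreparable N b φ := by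
  obtain ⟨c', d', hbound⟩ := PolyBound.id.add
    ((PolyBound.const c).mul ((PolyBound.id.add (.const 1)).pow d))
  refine ⟨c', d', fun k m => ?_⟩
  obtain ⟨a, K, hK, -, hact⟩ :=
    (transforms_ket_clear (regBits (regSize (N k)) (b k))).trans (h k m)
  refine ⟨a, K, hK.trans (le_trans ?_ (hbound (regSize (N k) + m))), ?_⟩
  · simp only [Fintype.card_fin]
    gcongr
    omega
  · rw [zero_add, embed_embed, embed_single] at hact
    rw [embed_single]
    exact hact

/-! ### Assembly of the walk operator -/

theorem efficientlyImplementable_walkOp {ι : Type*} {N : ι → ℕ}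
    {P : ∀ k, Matrix (Fin (N k)) (Fin (N k)) ℝ}
    (hP : ∀ k, P k ∈ Matrix.colStochastic ℝ (Fin (N k))) {r : ∀ k, Fin (N k)}
    {T : ∀ k, Fin (N k) → Matrix (Fin (N k)) (Fin (N k)) ℂ}
    (hT_unitary : ∀ k i, T k i ∈ Matrix.unitaryGroup (Fin (N k)) ℂ)
    (hT : ∀ k i, T k i *ᵥ colState (P k) i = colState (P k) (r k))
    (hT_eff : EfficientlyImplementable N fun k => controlledOp (T k))
    (hT_inv_eff : EfficientlyImplementable N fun k => (controlledOp (T k))⁻¹) {c d : ℕ}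
    (h : ∀ k m, Transforms (c * (regSize (N k) + m + 1) ^ d) (ket fun _ => false)
      (embed (fun j : Fin (N k) => regBits (regSize (N k)) j)
        (WithLp.toLp 2 (colState (P k) (r k)))) ((1 / 2) ^ m)) :
    EfficientlyImplementable N fun k => walkOp (P k) := by
  obtain ⟨c₁, d₁, h₁⟩ := hT_eff
  obtain ⟨c₂, d₂, h₂⟩ := hT_inv_eff
  have hlin : ∀ e : ℕ, PolyBound fun s => e * (s + 1) := fun e =>
    (PolyBound.const e).mul (PolyBound.id.add (.const 1))
  obtain ⟨c', d', hbound⟩ := ((PolyBound.const c₁).mul ((hlin 3).pow d₁)).add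
    (((((PolyBound.const 38).mul ((PolyBound.const c).mul ((hlin 5).pow d))).add
      ((PolyBound.const 36).mul .id)).add (.const 13)).add
    (((PolyBound.const c₂).mul ((hlin 3).pow d₂)).add ((PolyBound.const 3).mul .id)))
  refine ⟨c', d', fun k m => ?_⟩
  set n := regSize (N k) with hn
  have hN : N k ≤ 2 ^ n := Nat.le_pow_clog (by norm_num) _
  have hdot := star_dotProduct_colState (hP k) (r k)
  -- The encoding `enc₂` agrees definitionally with `anc` after `regPair`.
  have hT₁ : Impl (regPair (N k)) (c₁ * (n + (m + 2) + 1) ^ d₁) (controlledOp (T k))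
      ((1 / 2) ^ (m + 2)) := h₁ k (m + 2)
  have hT₂ : Impl (regPair (N k)) (c₂ * (n + (m + 2) + 1) ^ d₂) (controlledOp (T k))⁻¹
      ((1 / 2) ^ (m + 2)) := h₂ k (m + 2)
  -- Here n bits offset the factor N ≤ 2^n, and 4 bits turn the factor 4 into 1/4. With the two
  -- errors 2⁻ᵐ/4 of 𝒯 and 𝒯⁻¹ and the exact swap, the total is 3/4 of the allowance.
  have hR := impl_reflection (norm_toLp_eq_one hdot) (h k (m + n + 4))
  have hTU : controlledOp (T k) ∈ Matrix.unitaryGroup (Fin (N k) × Fin (N k)) ℂ := by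
    rw [controlledOp_eq_blk]
    exact blk_mem_unitaryGroup (hT_unitary k)
  have hTU' : (controlledOp (T k))⁻¹ ∈ Matrix.unitaryGroup (Fin (N k) × Fin (N k)) ℂ := by
    rw [controlledOp_inv (hT_unitary k)]
    exact blk_mem_unitaryGroup fun i => Unitary.star_mem (hT_unitary k i)
  have hRU : blk (fun _ => reflMatrix (colState (P k) (r k))) ∈
      Matrix.unitaryGroup (Fin (N k) × Fin (N k)) ℂ := by
    refine blk_mem_unitaryGroup fun _ => ?_
    rw [Matrix.mem_unitaryGroup_iff, Matrix.star_eq_conjTranspose, conjTranspose_reflMatrix,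
      reflMatrix_mul_self _ hdot]
  have hfin := hT₁.comp (hR.comp (hT₂.comp (impl_swapOp (N k)) hTU') hRU) hTU
  have heq : swapOp (N k) * (controlledOp (T k))⁻¹ *
      (blk fun _ => reflMatrix (colState (P k) (r k))) * controlledOp (T k) = walkOp (P k) := by
    rw [walkOp_eq (P k) (hT_unitary k) (hT k)]
    simp only [Matrix.mul_assoc]
  rw [heq] at hfin
  refine hfin.mono (L' := c' * (n + m + 1) ^ d') (ε' := (1 / 2) ^ m) ?_ ?_
  · refine le_trans ?_ (hbound (n + m))
    have e₁ : n + (m + 2) + 1 ≤ 3 * (n + m + 1) := by omega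
    have e₂ : n + (m + n + 4) + 1 ≤ 5 * (n + m + 1) := by omega
    have e₃ : n ≤ n + m := by omega
    simp only [← hn]
    gcongr
  · have hN' : (N k : ℝ) ≤ 2 ^ n := by exact_mod_cast hN
    have h3 : (2 : ℝ) ^ n * (1 / 2) ^ n = 1 := by rw [← mul_pow]; norm_num
    have h4 : (N k : ℝ) * (4 * (1 / 2) ^ (m + n + 4)) ≤ (1 / 2) ^ m * (1 / 4) := by
      calc (N k : ℝ) * (4 * (1 / 2) ^ (m + n + 4)) ≤ 2 ^ n * (4 * (1 / 2) ^ (m + n + 4)) := by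
            gcongr
        _ = (1 / 2) ^ m * (2 ^ n * (1 / 2) ^ n) * (1 / 4) := by
            rw [pow_add, pow_add]
            norm_num
            ring
        _ = _ := by rw [h3]; ring
    have h5 : (0 : ℝ) < (1 / 2) ^ m := by positivity
    have h6 : ((1 : ℝ) / 2) ^ (m + 2) = (1 / 2) ^ m * (1 / 4) := by rw [pow_add]; norm_num
    rw [h6]
    linarith

end SzegedyWalk

end

theorem corollary1 {ι : Type*} (N : ι → ℕ)
    (P : ∀ k, Matrix (Fin (N k)) (Fin (N k)) ℝ)
    (hP : ∀ k, P k ∈ Matrix.colStochastic ℝ (Fin (N k)))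
    (r : ∀ k, Fin (N k))
    (T : ∀ k, Fin (N k) → Matrix (Fin (N k)) (Fin (N k)) ℂ)
    (hT_unitary : ∀ k i, T k i ∈ Matrix.unitaryGroup (Fin (N k)) ℂ)
    (hT : ∀ k i, T k i *ᵥ SzegedyWalk.colState (P k) i = SzegedyWalk.colState (P k) (r k))
    (hT_eff : SzegedyWalk.EfficientlyImplementable N fun k => SzegedyWalk.controlledOp (T k))
    (hT_inv_eff :
      SzegedyWalk.EfficientlyImplementable N fun k => (SzegedyWalk.controlledOp (T k))⁻¹)
    (p : ι → ℝ → ℝ) (z₀ Δz : ι → ℝ) (hΔz : ∀ k, 0 < Δz k)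
    (hp : ∀ k, SzegedyWalk.IsDensityOn (p k) (z₀ k) (z₀ k + N k * Δz k))
    (hPp : ∀ k (j : Fin (N k)), P k j (r k) =
      ∫ z in (z₀ k + (j : ℕ) * Δz k)..(z₀ k + ((j : ℕ) + 1) * Δz k), p k z)
    (hp_eff : SzegedyWalk.EfficientlyIntegrable N p z₀ Δz) :
    (SzegedyWalk.EfficientlyImplementable N fun k => SzegedyWalk.walkOp (P k)) ∧
    ∀ b : ∀ k, Fin (N k),
      SzegedyWalk.EfficientlyPreparable N b fun k => SzegedyWalk.colState (P k) (r k) := by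
  obtain ⟨c, d, h⟩ := SzegedyWalk.transforms_colState hΔz hp hPp hp_eff
  exact ⟨SzegedyWalk.efficientlyImplementable_walkOp hP hT_unitary hT hT_eff hT_inv_eff h,
    SzegedyWalk.efficientlyPreparable_of_transforms h⟩
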